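/- **Parity games and the algorithm.** A parity game has finitely many vertices, each owned by one of the players Even and Odd and carrying a priority in $\mathbb N$, and a left-total edge relation. For a player $\alpha$ let $\overline\alpha$ be the opponent. $\mathrm{Attr}^G_\alpha(A)$ is the least set $Z\supseteq A$ of vertices of $G$ that contains every vertex of $\alpha$ with a successor in $Z$ and every vertex of $\overline\alpha$ all of whose successors in $G$ are in $Z$. Zielonka's recursive algorithm $\mathrm{Zlk}(G)$ returns $(\emptyset,\emptyset)$ on the empty game. Otherwise let $p$ be the highest priority in $G$, let $\alpha$ be the player with the parity of $p$, let $T$ be the set of vertices of priority $p$, and $A=\mathrm{Attr}^G_\alpha(T)$; compute $(W_{\mathrm{Even}},W_{\mathrm{Odd}})=\mathrm{Zlk}(G\setminus A)$ and $B=\mathrm{Attr}^G_{\overline\alpha}(W_{\overline\alpha})$. If $B=W_{\overline\alpha}$, add $A$ to $W_\alpha$ and return. If $B\ne W_{\overline\alpha}$, the vertices in $T\cap B$ are *identified as distractions*, $(W_{\mathrm{Even}},W_{\mathrm{Odd}})$ is recomputed as $\mathrm{Zlk}(G\setminus B)$, $B$ is added to $W_{\overline\alpha}$, and the result is returned. **The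 $N$-bit Two Counters game** ($N\ge1$). For each player $\alpha$ and each bit $k\in\{0,\dots,N-1\}$ (bit $0$ is the highest) there are vertices $l_\alpha(k)$, $t$, $h$, $s_0,\dots,s_k$, $a_0,\dots,a_{k-1}$, $b_0,\dots,b_{k-1}$. The vertices $s_j$ belong to $\alpha$, the others to $\overline\alpha$. The edges are $l_\alpha(k)\to t$; $t\to h$; $t\to s_0$; $s_j\to a_j$, $s_j\to b_j$, $a_j\to s_{j+1}$, $b_j\to s_{j+1}$, $a_j\to l_\alpha(j)$, $b_j\to l_{\overline\alpha}(j)$ for $j<k$; $s_k\to t$; $s_k\to l_{\overline\alpha}(m)$ for $k<m<N$, and also for $m=k$ if $\alpha$ is Odd; $h\to l_\alpha(k-1)$ if $k>0$, and $h\to l_\alpha(N-1)$ if $k=0$. The priority of $l_\alpha(k)$ is $2(N-k)+1$ for Even and $2(N-k)+2$ for Odd; the priority of $h$ is larger than that by $2N+1$; $t$ has priority $2$ for Even and $1$ for Odd; the vertices $s_j,a_j,b_j$ have the priority of $t$ minus $1$. Say that bit $k$ of $\alpha$ is *set* at some moment of the execution if $l_\alpha(k)$ has been identified as a distraction and has not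 been part of a recomputed subgame $G\setminus B$ since. The counter of $\alpha$ shows the number in which bit $k$ has weight $2^{N-1-k}$. **Lemma 1.** Let $N\ge1$. When Zielonka's recursive algorithm solves the $N$-bit Two Counters game, the sequence of identified distractions follows the progression of a binary counter: exactly $3(2^N-1)$ identifications occur, and they come in $2^N-1$ consecutive groups of three. The group with number $i$ ($0\le i<2^N-1$) identifies exactly $l_{\mathrm{Even}}(k)$, then $l_{\mathrm{Odd}}(k)$, then $l_{\mathrm{Even}}(k)$ again, for some bit $k$. After $i$ groups ($0\le i\le 2^N-1$) both counters show $i$. Before the identification of $l_{\mathrm{Odd}}(k)$ in a group, bit $k$ of Odd is unset and all lower bits of Odd are set; after it, bit $k$ is set, all lower bits of Odd are reset, and the higher bits of Odd are unchanged. The same holds for Even between the start and the end of each group. Consequently the number $c_N$ of recursive calls on nonempty games (the initial call included) is exponential: $2(2^N-1)\le c_N\le 6\cdot 2^N$. The game has $n=3N^2+5N$ vertices, so that $c_N=\Omega\bigl(2^{\sqrt{n/3}}\bigr)$, a lower bound of the form $2^{\Omega(\sqrt n)}$. -/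

import Mathlib

/-! ### Parity games -/

/-- The two players of a parity game. -/
inductive Player where
  | even
  | odd
  deriving DecidableEq

namespace Player

instance : Fintype Player where
  elems := {even, odd}
  complete := by
    intro c
    cases c <;> simp

/-- The opponent of a player. -/
def opp : Player → Player
  | even => odd
  | odd => even

/-- The player who wins the priority `p`, that is, the player `p mod 2`. -/
def ofPriority (p : ℕ) : Player := if p % 2 = 0 then even else odd

end Player

/-- A parity game on the vertex set `V`: each vertex has an owner and a priority, and the edge
relation is left-total. -/
structure ParityGame (V : Type*) where
  owner : V → Player
  edge : V → V → Prop
  priority : V → ℕ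
  total : ∀ v, ∃ w, edge v w

namespace ParityGame

variable {V : Type*}

/-- The `α`-attractor of `A` in the subgame with vertex set `S`, as a least fixpoint. -/
inductive Attracted (G : ParityGame V) (S : Finset V) (α : Player) (A : Finset V) : V → Prop
  | base {v : V} : v ∈ S → v ∈ A → Attracted G S α A v
  | own {v w : V} : v ∈ S → G.owner v = α → G.edge v w → Attracted G S α A w →
      Attracted G S α A v
  | opponent {v : V} : v ∈ S → G.owner v = α.opp →
      (∀ w ∈ S, G.edge v w → Attracted G S α A w) → Attracted G S α A v

open Classical in
/-- The `α`-attractor of `A` in the subgame with vertex set `S`. -/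
noncomputable def attr (G : ParityGame V) (S : Finset V) (α : Player) (A : Finset V) : Finset V :=
  S.filter (G.Attracted S α A)

theorem attr_subset (G : ParityGame V) (S : Finset V) (α : Player) (A : Finset V) :
    G.attr S α A ⊆ S := by
  classical
  exact Finset.filter_subset _ _

theorem mem_attr {G : ParityGame V} {S : Finset V} {α : Player} {A : Finset V} {v : V} :
    v ∈ G.attr S α A ↔ G.Attracted S α A v := by
  classical
  refine ⟨fun hv => (Finset.mem_filter.mp hv).2, fun hv => Finset.mem_filter.mpr ⟨?_, hv⟩⟩
  cases hv <;> assumption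

/-- The vertices of highest priority in the subgame with vertex set `S`. -/
def top (G : ParityGame V) (S : Finset V) : Finset V :=
  S.filter (fun v => G.priority v = S.sup G.priority)

/-- An event in the execution of the recursive algorithm: a set of vertices of the highest priority
of the current subgame is attracted by the opponent, so these vertices are identified as
distractions, and consequently the subgame on `recomputed` is solved anew. -/
structure Event (V : Type*) where
  identified : Finset V
  recomputed : Finset V

/-- The result of an execution of the recursive algorithm: the computed winning regions, the number
of calls on nonempty games (the initial call included), and the chronological list of events. -/
structure Run (V : Type*) where
  win : Player → Finset V
  calls : ℕ
  events : List (Event V)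

section Zielonka

variable [DecidableEq V]

/-- The recursive algorithm on the subgame of `G` with vertex set `S`, bundled with the fact that
the computed regions lie in `S` (needed for termination only). -/
noncomputable def zielonkaAux (G : ParityGame V) (S : Finset V) :
    {r : Run V // ∀ α, r.win α ⊆ S} :=
  if hS : S = ∅ then
    ⟨{ win := fun _ => ∅, calls := 0, events := [] }, fun _ => Finset.empty_subset _⟩
  else
    let α := Player.ofPriority (S.sup G.priority)
    let A := G.attr S α (G.top S)
    let r := zielonkaAux G (S \ A)
    let B := G.attr S α.opp (r.1.win α.opp)
    if hB : B = r.1.win α.opp then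
      ⟨{ win := fun β => if β = α then r.1.win β ∪ A else r.1.win β
         calls := r.1.calls + 1
         events := r.1.events }, by
        intro β
        have h1 : r.1.win β ⊆ S := (r.2 β).trans Finset.sdiff_subset
        have h2 : A ⊆ S := G.attr_subset _ _ _
        dsimp only
        split_ifs
        · exact Finset.union_subset h1 h2
        · exact h1⟩
    else
      let r' := zielonkaAux G (S \ B)
      ⟨{ win := fun β => if β = α.opp then r'.1.win β ∪ B else r'.1.win β
         calls := r.1.calls + r'.1.calls + 1
         events := r.1.events ++ ⟨G.top S ∩ B, S \ B⟩ :: r'.1.events }, by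
        intro β
        have h1 : r'.1.win β ⊆ S := (r'.2 β).trans Finset.sdiff_subset
        have h2 : B ⊆ S := G.attr_subset _ _ _
        dsimp only
        split_ifs
        · exact Finset.union_subset h1 h2
        · exact h1⟩
termination_by S.card
decreasing_by
  · apply Finset.card_lt_card
    obtain ⟨v, hv, hp⟩ := Finset.exists_mem_eq_sup S (Finset.nonempty_iff_ne_empty.mpr hS)
      G.priority
    refine Finset.sdiff_ssubset (G.attr_subset _ _ _) ⟨v, ?_⟩
    exact mem_attr.mpr (.base hv (Finset.mem_filter.mpr ⟨hv, hp.symm⟩))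
  · apply Finset.card_lt_card
    refine Finset.sdiff_ssubset (G.attr_subset _ _ _) ?_
    rw [Finset.nonempty_iff_ne_empty]
    intro h0
    apply hB
    change B = ∅ at h0
    rw [h0]
    symm
    rw [Finset.eq_empty_iff_forall_notMem]
    intro v hv
    have hvS : v ∈ S := Finset.sdiff_subset (r.2 _ hv)
    have : v ∈ B := mem_attr.mpr (.base hvS hv)
    rw [h0] at this
    exact Finset.notMem_empty v this

/-- Zielonka's recursive algorithm on the subgame of `G` with vertex set `S`. -/
noncomputable def zielonka (G : ParityGame V) (S : Finset V) : Run V := (G.zielonkaAux S).1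

/-- The defining recursion of the algorithm, free of the termination bookkeeping. -/
theorem zielonka_eq (G : ParityGame V) (S : Finset V) :
    G.zielonka S =
      if S = ∅ then { win := fun _ => ∅, calls := 0, events := [] }
      else
        let α := Player.ofPriority (S.sup G.priority)
        let A := G.attr S α (G.top S)
        let r := G.zielonka (S \ A)
        let B := G.attr S α.opp (r.win α.opp)
        if B = r.win α.opp then
          { win := fun β => if β = α then r.win β ∪ A else r.win β
            calls := r.calls + 1
            events := r.events }
        else
          let r' := G.zielonka (S \ B)
          { win := fun β => if β = α.opp then r'.win β ∪ B else r'.win β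
            calls := r.calls + r'.calls + 1
            events := r.events ++ ⟨G.top S ∩ B, S \ B⟩ :: r'.events } := by
  unfold zielonka
  conv_lhs => rw [zielonkaAux]
  dsimp only
  split_ifs <;> rfl

/-- The distractions that count as identified after the events `es`: those that have been
identified and have not been part of a recomputed subgame since. -/
def identifiedAfter (es : List (Event V)) : Finset V :=
  es.foldl (fun X e => (X \ e.recomputed) ∪ e.identified) ∅

end Zielonka

end ParityGame

/-! ### The Two Counters game -/

namespace TwoCounters

/-- The vertices of the `N`-bit Two Counters game. The bit `k` of player `c` (bit `0` is the highest
bit) consists of the low vertex `l`, the tangle vertex `t`, the high vertex `h`, and the path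
`s 0, {a 0, b 0}, s 1, …, {a (k-1), b (k-1)}, s k`, whose last vertex `s k` is the vertex `z`. -/
inductive Vertex (N : ℕ) where
  | l (c : Player) (k : Fin N)
  | t (c : Player) (k : Fin N)
  | h (c : Player) (k : Fin N)
  | s (c : Player) (k : Fin N) (j : Fin (k.val + 1))
  | a (c : Player) (k : Fin N) (j : Fin k.val)
  | b (c : Player) (k : Fin N) (j : Fin k.val)
  deriving DecidableEq, Fintype

/-- The vertices `s` (with `z`) of a bit belong to the player of the bit, the others to the
opponent. -/
def owner {N : ℕ} : Vertex N → Player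
  | .l c _ => c.opp
  | .t c _ => c.opp
  | .h c _ => c.opp
  | .s c _ _ => c
  | .a c _ _ => c.opp
  | .b c _ _ => c.opp

/-- The priority of the low vertex of bit `k` of player `c`; it has the parity of the opponent. -/
def lowPriority (N : ℕ) (c : Player) (k : Fin N) : ℕ :=
  match c with
  | .even => 2 * (N - k.val) + 1
  | .odd => 2 * (N - k.val) + 2

/-- The priority of the tangle vertex of a bit of player `c`. -/
def tanglePriority : Player → ℕ
  | .even => 2
  | .odd => 1

def priority {N : ℕ} : Vertex N → ℕ
  | .l c k => lowPriority N c k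
  | .t c _ => tanglePriority c
  | .h c k => lowPriority N c k + (2 * N + 1)
  | .s c _ _ => tanglePriority c - 1
  | .a c _ _ => tanglePriority c - 1
  | .b c _ _ => tanglePriority c - 1

/-- The edges of the `N`-bit Two Counters game, where player Even counts first. -/
inductive Edge {N : ℕ} : Vertex N → Vertex N → Prop
  | l_t (c : Player) (k : Fin N) : Edge (.l c k) (.t c k)
  | t_h (c : Player) (k : Fin N) : Edge (.t c k) (.h c k)
  | t_s (c : Player) (k : Fin N) : Edge (.t c k) (.s c k 0)
  | h_next (c : Player) (k m : Fin N) : m.val + 1 = k.val → Edge (.h c k) (.l c m)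
  | h_last (c : Player) (k m : Fin N) : k.val = 0 → m.val + 1 = N → Edge (.h c k) (.l c m)
  | s_a (c : Player) (k : Fin N) (j : Fin k.val) : Edge (.s c k j.castSucc) (.a c k j)
  | s_b (c : Player) (k : Fin N) (j : Fin k.val) : Edge (.s c k j.castSucc) (.b c k j)
  | a_s (c : Player) (k : Fin N) (j : Fin k.val) : Edge (.a c k j) (.s c k j.succ)
  | b_s (c : Player) (k : Fin N) (j : Fin k.val) : Edge (.b c k j) (.s c k j.succ)
  | a_l (c : Player) (k : Fin N) (j : Fin k.val) :
      Edge (.a c k j) (.l c ⟨j.val, j.isLt.trans k.isLt⟩)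
  | b_l (c : Player) (k : Fin N) (j : Fin k.val) :
      Edge (.b c k j) (.l c.opp ⟨j.val, j.isLt.trans k.isLt⟩)
  | z_t (c : Player) (k : Fin N) : Edge (.s c k (Fin.last k.val)) (.t c k)
  | z_l (c : Player) (k m : Fin N) : k < m → Edge (.s c k (Fin.last k.val)) (.l c.opp m)
  | z_same (k : Fin N) : Edge (.s .odd k (Fin.last k.val)) (.l .even k)

theorem edge_total {N : ℕ} (v : Vertex N) : ∃ w, Edge v w := by
  cases v with
  | l c k => exact ⟨_, .l_t c k⟩
  | t c k => exact ⟨_, .t_h c k⟩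
  | h c k =>
    rcases Nat.eq_zero_or_pos k.val with hk | hk
    · exact ⟨_, .h_last c k ⟨N - 1, by have := k.isLt; omega⟩ hk
        (by have := k.isLt; simp only; omega)⟩
    · exact ⟨_, .h_next c k ⟨k.val - 1, by have := k.isLt; omega⟩ (by simp only; omega)⟩
  | s c k j =>
    induction j using Fin.lastCases with
    | last => exact ⟨_, .z_t c k⟩
    | cast i => exact ⟨_, .s_a c k i⟩
  | a c k j => exact ⟨_, .a_s c k j⟩
  | b c k j => exact ⟨_, .b_s c k j⟩

/-- The `N`-bit Two Counters game. -/
def game (N : ℕ) : ParityGame (Vertex N) where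
  owner := owner
  edge := Edge
  priority := priority
  total := edge_total

/-- The execution of the recursive algorithm on the `N`-bit Two Counters game. -/
noncomputable def run (N : ℕ) : ParityGame.Run (Vertex N) := (game N).zielonka Finset.univ

/-- The identified distractions after the first `m` events of the execution. -/
noncomputable def state (N m : ℕ) : Finset (Vertex N) :=
  ParityGame.identifiedAfter ((run N).events.take m)

/-- The number shown by the counter of player `c`, when bit `k` is set if and only if its low
vertex is in `X`; bit `0` is the most significant bit. -/
def counterValue {N : ℕ} (c : Player) (X : Finset (Vertex N)) : ℕ :=
  ∑ k : Fin N, if Vertex.l c k ∈ X then 2 ^ (N - 1 - k.val) else 0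

/-- Passing from `X` to `Y` sets bit `k` of player `c`: all lower bits are set before and are reset
afterwards, and the higher bits do not change. -/
def SetsBit {N : ℕ} (c : Player) (k : Fin N) (X Y : Finset (Vertex N)) : Prop :=
  Vertex.l c k ∉ X ∧ Vertex.l c k ∈ Y ∧
  (∀ j, k < j → Vertex.l c j ∈ X ∧ Vertex.l c j ∉ Y) ∧
  (∀ j, j < k → (Vertex.l c j ∈ X ↔ Vertex.l c j ∈ Y))

end TwoCounters

/-!
Each subgame that the algorithm meets below the high vertices is determined by a few data. Let
`sub k x P` be the game on the bits `k, …, N - 1` of both players. Of the higher bits only traces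
are left: at position `j < k` of every path the vertex `a` is present if bit `j` has been set
(`x j`), and the vertex `b` otherwise; and if `P` holds, the tangle of bit `k - 1` of Even, which is
harmless, is still there. Solving `sub k x P` for `k < N` goes as follows.

* The top vertex is `l odd k`. Its Even-attractor removes the exits `a` to it and the tangle in `P`.
  In the rest, `subOdd k x`, the top vertex is `l even k`. Its Odd-attractor removes the tangle of
  bit `k` of Odd, whose last vertex leads to `l even k`, and leaves `subUnset k x`, which is a game
  `sub (k + 1) _ True` with bit `k` unset.
* Even wins her tangle of bit `k` there, hence attracts `l even k` (first event), and then
  everything but the tangle of bit `k` of Odd (`attr_win_even`). Odd wins this tangle.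
* Hence Odd attracts `l odd k` (second event). The attractor (`attr_tangleOdd`) takes the exits `b`
  to `l odd k`, so that the rest, `subSet k x P`, contains all bits of Even and the lower bits of
  Odd again. Its top vertex is `l even k`, whose Odd-attractor is everything but the tangles of bit `k`
  of Even and in `P` (`attr_low_even_of_set`). Even wins these and attracts `l even k` (third
  event).
* What remains is `subNext k x`, the game `sub (k + 1) _ False` with bit `k` set.

So the events for `sub k x P` are those of two games `sub (k + 1) _ _` with a round of three events
in between (`zielonka_sub_step`), and by induction the calls can be counted exactly
(`zielonka_sub`). The high vertices are removed one at a time before all this, without events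
(`zielonka_withHigh_step`). The shape of the event list, abstracted as `Counts`, is that of a binary
counter, which is the content of `Counts.spec`.

Attractors are computed through their complements: a set containing all vertices that are not
attracted is the complement of the attractor if it is a trap (`ParityGame.attr_eq_sdiff`). It is
therefore convenient to name the complements, and all of them are of a common form (`Shape`).
-/

/-! ### Attractors and single calls of the algorithm -/

namespace Player

@[simp] theorem opp_opp (c : Player) : c.opp.opp = c := by cases c <;> rfl
@[simp] theorem opp_ne (c : Player) : c.opp ≠ c := by cases c <;> simp [Player.opp]
@[simp] theorem ne_opp (c : Player) : c ≠ c.opp := by cases c <;> simp [Player.opp]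
@[simp] theorem opp_eq_even {c : Player} : c.opp = .even ↔ c = .odd := by
  cases c <;> simp [Player.opp]
@[simp] theorem opp_eq_odd {c : Player} : c.opp = .odd ↔ c = .even := by
  cases c <;> simp [Player.opp]
@[simp] theorem opp_even : Player.even.opp = .odd := rfl
@[simp] theorem opp_odd : Player.odd.opp = .even := rfl

end Player

namespace ParityGame

variable {V : Type*}

theorem Attracted.mem {G : ParityGame V} {S : Finset V} {α : Player} {A : Finset V} {v : V}
    (h : G.Attracted S α A v) : v ∈ S := by
  cases h <;> assumption

theorem sup_priority_eq {G : ParityGame V} {S : Finset V} {v : V} (hv : v ∈ S)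
    (hlt : ∀ w ∈ S, G.priority w ≤ G.priority v) : S.sup G.priority = G.priority v :=
  le_antisymm (Finset.sup_le hlt) (Finset.le_sup hv)

variable [DecidableEq V]

/-- A trap `R` outside of which all vertices are attracted is the complement of the attractor. -/
theorem attr_eq_sdiff {G : ParityGame V} {S R : Finset V} {α : Player} {A : Finset V}
    (h1 : ∀ v ∈ S, v ∉ R → G.Attracted S α A v)
    (h2 : ∀ v ∈ R, v ∉ A)
    (h3 : ∀ v w, v ∈ R → G.owner v = α → w ∈ S → G.edge v w → w ∈ R)
    (h4 : ∀ v ∈ R, G.owner v = α.opp → ∃ w ∈ R, w ∈ S ∧ G.edge v w) :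
    G.attr S α A = S \ R := by
  ext v
  rw [mem_attr, Finset.mem_sdiff]
  refine ⟨fun h => ⟨h.mem, ?_⟩, fun h => h1 v h.1 h.2⟩
  induction h with
  | base _ hA => exact fun hR => h2 _ hR hA
  | own _ ho he hw ih => exact fun hR => ih (h3 _ _ hR ho hw.mem he)
  | opponent _ ho _ ih =>
    intro hR
    obtain ⟨w, hwR, hwS, he⟩ := h4 _ hR ho
    exact ih w hwS he hwR

theorem top_eq_singleton {G : ParityGame V} {S : Finset V} {v : V} (hv : v ∈ S)
    (hlt : ∀ w ∈ S, w ≠ v → G.priority w < G.priority v) : G.top S = {v} := by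
  have hs : S.sup G.priority = G.priority v := sup_priority_eq hv fun w hw => by
    by_cases h : w = v
    · rw [h]
    · exact (hlt w hw h).le
  ext w
  simp only [top, Finset.mem_filter, Finset.mem_singleton, hs]
  refine ⟨fun h => ?_, ?_⟩
  · by_contra hne
    exact (hlt w h.1 hne).ne h.2
  · rintro rfl
    exact ⟨hv, rfl⟩

/-- A call in which the unique vertex `v` of highest priority is identified as a distraction. -/
theorem zielonka_of_event {G : ParityGame V} {S R R' : Finset V} {v : V} {α : Player}
    (hv : v ∈ S) (hlt : ∀ w ∈ S, w ≠ v → G.priority w < G.priority v)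
    (hα : Player.ofPriority (G.priority v) = α)
    (hR : R ⊆ S) (hA : G.attr S α {v} = S \ R) (hvW : v ∉ (G.zielonka R).win α.opp)
    (hR' : R' ⊆ S) (hB : G.attr S α.opp ((G.zielonka R).win α.opp) = S \ R') (hvR' : v ∉ R') :
    G.zielonka S =
      { win := fun β => if β = α.opp then (G.zielonka R').win β ∪ S \ R' else (G.zielonka R').win β
        calls := (G.zielonka R).calls + (G.zielonka R').calls + 1
        events := (G.zielonka R).events ++ ⟨{v}, R'⟩ :: (G.zielonka R').events } := by
  have hs : S.sup G.priority = G.priority v := sup_priority_eq hv fun w hw => by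
    by_cases h : w = v
    · rw [h]
    · exact (hlt w hw h).le
  have hvB : v ∈ S \ R' := Finset.mem_sdiff.mpr ⟨hv, hvR'⟩
  have hne : S \ R' ≠ (G.zielonka R).win α.opp := fun h => hvW (h ▸ hvB)
  rw [zielonka_eq, if_neg (Finset.ne_empty_of_mem hv)]
  simp only [hs, hα, top_eq_singleton hv hlt, hA, Finset.sdiff_sdiff_eq_self hR, hB, if_neg hne,
    Finset.sdiff_sdiff_eq_self hR', Finset.singleton_inter_of_mem hvB]

/-- A call in which no vertex of highest priority is identified as a distraction. -/
theorem zielonka_of_no_event {G : ParityGame V} {S R : Finset V} {v : V} {α : Player}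
    (hv : v ∈ S) (hle : ∀ w ∈ S, G.priority w ≤ G.priority v)
    (hα : Player.ofPriority (G.priority v) = α)
    (hR : R ⊆ S) (hA : G.attr S α (G.top S) = S \ R)
    (hB : G.attr S α.opp ((G.zielonka R).win α.opp) = (G.zielonka R).win α.opp) :
    G.zielonka S =
      { win := fun β => if β = α then (G.zielonka R).win β ∪ S \ R else (G.zielonka R).win β
        calls := (G.zielonka R).calls + 1
        events := (G.zielonka R).events } := by
  rw [zielonka_eq, if_neg (Finset.ne_empty_of_mem hv)]
  simp only [sup_priority_eq hv hle, hα, hA, Finset.sdiff_sdiff_eq_self hR, hB, if_true]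

theorem zielonka_empty (G : ParityGame V) :
    G.zielonka ∅ = { win := fun _ => ∅, calls := 0, events := [] } := by
  rw [zielonka_eq, if_pos rfl]

theorem attr_empty (G : ParityGame V) (S : Finset V) (hS : ∀ v ∈ S, ∃ w ∈ S, G.edge v w)
    (α : Player) : G.attr S α ∅ = ∅ := by
  rw [attr_eq_sdiff (R := S) (fun v h h' => absurd h h') (fun _ _ => Finset.notMem_empty _)
    (fun _ _ _ _ h _ => h) (fun v hv _ => by obtain ⟨w, hw, he⟩ := hS v hv; exact ⟨w, hw, hw, he⟩),
    Finset.sdiff_self]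

end ParityGame

/-! ### Vertex sets of the Two Counters game -/

namespace TwoCounters

open ParityGame

/-- A description of a set of vertices of the Two Counters game that treats the path vertices of a
bit alike: which low, tangle and high vertices are present, and at which positions the vertices `a`
and `b` of the present tangles are present. -/
structure Shape where
  low : Player → ℕ → Prop
  tangle : Player → ℕ → Prop
  high : Player → ℕ → Prop
  up : Player → ℕ → Prop
  down : Player → ℕ → Prop

namespace Shape

/-- The membership predicate of the set of vertices described by a shape. -/
def Has (S : Shape) {N : ℕ} : Vertex N → Prop
  | .l c k => S.low c k
  | .t c k => S.tangle c k
  | .h c k => S.high c k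
  | .s c k _ => S.tangle c k
  | .a c k j => S.tangle c k ∧ S.up c j
  | .b c k j => S.tangle c k ∧ S.down c j

open Classical in
/-- The set of vertices described by a shape. -/
noncomputable def verts (N : ℕ) (S : Shape) : Finset (Vertex N) := Finset.univ.filter S.Has

variable {N : ℕ} {S : Shape} {c : Player} {k : Fin N}

theorem mem_verts {v : Vertex N} : v ∈ S.verts N ↔ S.Has v := by simp [verts]

@[simp] theorem mem_l : Vertex.l c k ∈ S.verts N ↔ S.low c k := mem_verts
@[simp] theorem mem_t : Vertex.t c k ∈ S.verts N ↔ S.tangle c k := mem_verts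
@[simp] theorem mem_h : Vertex.h c k ∈ S.verts N ↔ S.high c k := mem_verts
@[simp] theorem mem_s {j} : Vertex.s c k j ∈ S.verts N ↔ S.tangle c k := mem_verts
@[simp] theorem mem_a {j} : Vertex.a c k j ∈ S.verts N ↔ S.tangle c k ∧ S.up c j := mem_verts
@[simp] theorem mem_b {j} : Vertex.b c k j ∈ S.verts N ↔ S.tangle c k ∧ S.down c j := mem_verts

/-- A closed shape: it contains enough vertices for every vertex to have a successor in it, see
`Closed.exists_edge`. -/
def Closed (S : Shape) : Prop :=
  (∀ c m, S.high c m → ∀ i, S.low c i) ∧ (∀ c m, S.low c m → S.tangle c m) ∧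
    ∀ c m j, j < m → S.tangle c m → S.up c j ∨ S.down c j

theorem Closed.exists_edge (hS : S.Closed) {v : Vertex N} (hv : v ∈ S.verts N) :
    ∃ w ∈ S.verts N, Edge v w := by
  obtain ⟨h1, h2, h3⟩ := hS
  cases v with
  | l c m => exact ⟨.t c m, mem_t.mpr (h2 _ _ (mem_l.mp hv)), .l_t ..⟩
  | h c m =>
    obtain ⟨w, hw⟩ := edge_total (Vertex.h c m)
    refine ⟨w, ?_, hw⟩
    cases hw <;> exact mem_l.mpr (h1 _ _ (mem_h.mp hv) _)
  | t c m => exact ⟨.s c m 0, mem_s.mpr (mem_t.mp hv), .t_s ..⟩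
  | a c m j => exact ⟨.s c m j.succ, mem_s.mpr (mem_a.mp hv).1, .a_s ..⟩
  | b c m j => exact ⟨.s c m j.succ, mem_s.mpr (mem_b.mp hv).1, .b_s ..⟩
  | s c m j =>
    induction j using Fin.lastCases with
    | last => exact ⟨.t c m, mem_t.mpr (mem_s.mp hv), .z_t ..⟩
    | cast j =>
      rcases h3 c m j j.isLt (mem_s.mp hv) with h | h
      · exact ⟨.a c m j, mem_a.mpr ⟨mem_s.mp hv, h⟩, .s_a ..⟩
      · exact ⟨.b c m j, mem_b.mpr ⟨mem_s.mp hv, h⟩, .s_b ..⟩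

theorem attr_eq_sdiff {S R : Shape} {α : Player} {A : Finset (Vertex N)} (hR : R.Closed)
    (hRS : R.verts N ⊆ S.verts N)
    (h1 : ∀ v ∈ S.verts N, v ∉ R.verts N → (game N).Attracted (S.verts N) α A v)
    (h2 : ∀ v ∈ R.verts N, v ∉ A)
    (h3 : ∀ v w, Edge v w → v ∈ R.verts N → owner v = α → w ∈ S.verts N → w ∈ R.verts N) :
    (game N).attr (S.verts N) α A = S.verts N \ R.verts N :=
  ParityGame.attr_eq_sdiff h1 h2 (fun v w hv ho hw he => h3 v w he hv ho hw) fun v hv _ => by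
    obtain ⟨w, hw, he⟩ := hR.exists_edge hv
    exact ⟨w, hw, hRS hw, he⟩

end Shape

/-- The game on the bits from `k` on, for both players. Of the higher bits
`j < k` only a trace remains: at position `j` of each path the vertex `a` is left if `x j`, and the
vertex `b` otherwise.
If `P` holds, the tangle of the bit `k - 1` of Even is present too. -/
def sub (k : ℕ) (x : ℕ → Prop) (P : Prop) : Shape where
  low _ m := k ≤ m
  tangle c m := k ≤ m ∨ (P ∧ c = .even ∧ m + 1 = k)
  high _ _ := False
  up _ j := k ≤ j ∨ x j
  down _ j := k ≤ j ∨ ¬ x j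

/-- The game `sub k x P` without the Even-attractor of the low vertex of bit `k` of Odd. -/
def subOdd (k : ℕ) (x : ℕ → Prop) : Shape where
  low c m := k ≤ m ∧ ¬ (c = .odd ∧ m = k)
  tangle _ m := k ≤ m
  high _ _ := False
  up c j := (k ≤ j ∨ x j) ∧ ¬ (c = .odd ∧ j = k)
  down _ j := k ≤ j ∨ ¬ x j

/-- The game `sub k x P` without the Odd-attractor of the tangle of bit `k` of Odd. -/
def subSet (k : ℕ) (x : ℕ → Prop) (P : Prop) : Shape where
  low c m := k ≤ m ∧ ¬ (c = .odd ∧ m = k)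
  tangle c m := (k ≤ m ∧ ¬ (c = .odd ∧ m = k)) ∨ (P ∧ c = .even ∧ m + 1 = k)
  high _ _ := False
  up _ j := k ≤ j ∨ x j
  down c j := (k ≤ j ∨ ¬ x j) ∧ ¬ (c = .even ∧ j = k)

/-- The tangles of the bits of player `c` in `T`, with the positions of their paths given by `x`. -/
def tangles (c : Player) (T : ℕ → Prop) (x : ℕ → Prop) : Shape where
  low _ _ := False
  tangle d m := d = c ∧ T m
  high _ _ := False
  up _ j := x j
  down _ j := ¬ x j

@[simp] theorem game_owner {N : ℕ} (v : Vertex N) : (game N).owner v = owner v := rfl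
@[simp] theorem game_priority {N : ℕ} (v : Vertex N) : (game N).priority v = priority v := rfl

/-! ### Attraction along the paths of a bit -/

section Paths

variable {N : ℕ} {S : Shape} {α c : Player} {A : Finset (Vertex N)} {m : Fin N}

theorem attracted_a_own (hm : S.tangle c m) (j : Fin m) (hj : S.up c j)
    (hs : (game N).Attracted (S.verts N) c A (.s c m j.succ))
    (hl : S.low c j → (game N).Attracted (S.verts N) c A (.l c ⟨j, j.isLt.trans m.isLt⟩)) :
    (game N).Attracted (S.verts N) c A (.a c m j) := by
  refine .opponent (Shape.mem_a.mpr ⟨hm, hj⟩) rfl fun w hw he => ?_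
  cases he with
  | a_s => exact hs
  | a_l => exact hl ((Shape.mem_l (N := N)).mp hw)

theorem attracted_b_own (hm : S.tangle c m) (j : Fin m) (hj : S.down c j)
    (hs : (game N).Attracted (S.verts N) c A (.s c m j.succ))
    (hl : S.low c.opp j → (game N).Attracted (S.verts N) c A (.l c.opp ⟨j, j.isLt.trans m.isLt⟩)) :
    (game N).Attracted (S.verts N) c A (.b c m j) := by
  refine .opponent (Shape.mem_b.mpr ⟨hm, hj⟩) rfl fun w hw he => ?_
  cases he with
  | b_s => exact hs
  | b_l => exact hl ((Shape.mem_l (N := N)).mp hw)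

/-- The owner of a bit can walk along the path of its tangle if at each position the opponent
cannot leave the path from one of the vertices `a` and `b`, or only into the attractor. -/
theorem attracted_s_own (hm : S.tangle c m)
    (hj : ∀ j : Fin m,
      (S.up c j ∧ (S.low c j → (game N).Attracted (S.verts N) c A (.l c ⟨j, j.isLt.trans m.isLt⟩)))
      ∨ (S.down c j ∧ (S.low c.opp j →
        (game N).Attracted (S.verts N) c A (.l c.opp ⟨j, j.isLt.trans m.isLt⟩))))
    (hz : (game N).Attracted (S.verts N) c A (.s c m (Fin.last m))) (j : Fin (m + 1)) :
    (game N).Attracted (S.verts N) c A (.s c m j) := by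
  induction j using Fin.reverseInduction with
  | last => exact hz
  | cast i ih =>
    rcases hj i with h | h
    · exact .own (w := .a c m i) (Shape.mem_s.mpr hm) rfl (.s_a ..)
        (attracted_a_own hm i h.1 ih h.2)
    · exact .own (w := .b c m i) (Shape.mem_s.mpr hm) rfl (.s_b ..)
        (attracted_b_own hm i h.1 ih h.2)

theorem attracted_t_own (hm : S.tangle c m) (hh : ¬ S.high c m)
    (hs : (game N).Attracted (S.verts N) c A (.s c m 0)) :
    (game N).Attracted (S.verts N) c A (.t c m) := by
  refine .opponent (Shape.mem_t.mpr hm) rfl fun w hw he => ?_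
  cases he with
  | t_h => exact absurd (Shape.mem_h.mp hw) hh
  | t_s => exact hs

/-- The opponent of the owner of a bit can walk along the path of its tangle. -/
theorem attracted_s_opp (hm : S.tangle c m) {i : Fin (m + 1)}
    (hi : (game N).Attracted (S.verts N) c.opp A (.s c m i)) (j : Fin (m + 1)) (hji : j ≤ i) :
    (game N).Attracted (S.verts N) c.opp A (.s c m j) := by
  induction j using Fin.reverseInduction with
  | last => rwa [← Fin.last_le_iff.mp hji]
  | cast j ih =>
    rcases hji.eq_or_lt with h | h
    · rwa [h]
    have ih := ih (Fin.castSucc_lt_iff_succ_le.mp h)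
    refine .opponent (Shape.mem_s.mpr hm) (by simp [owner]) fun w hw he => ?_
    generalize hq : j.castSucc = q at he
    cases he with
    | s_a =>
      cases Fin.castSucc_injective _ hq
      exact .own hw rfl (.a_s ..) ih
    | s_b =>
      cases Fin.castSucc_injective _ hq
      exact .own hw rfl (.b_s ..) ih
    | z_t => exact absurd hq (Fin.castSucc_ne_last j)
    | z_l => exact absurd hq (Fin.castSucc_ne_last j)
    | z_same => exact absurd hq (Fin.castSucc_ne_last j)

theorem attracted_t_opp (hm : S.tangle c m)
    (hs : (game N).Attracted (S.verts N) c.opp A (.s c m 0)) :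
    (game N).Attracted (S.verts N) c.opp A (.t c m) :=
  .own (Shape.mem_t.mpr hm) rfl (.t_s ..) hs

theorem attracted_a_opp (hm : S.tangle c m) (j : Fin m) (hj : S.up c j)
    (hs : (game N).Attracted (S.verts N) c.opp A (.s c m j.succ)) :
    (game N).Attracted (S.verts N) c.opp A (.a c m j) :=
  .own (Shape.mem_a.mpr ⟨hm, hj⟩) rfl (.a_s ..) hs

theorem attracted_b_opp (hm : S.tangle c m) (j : Fin m) (hj : S.down c j)
    (hs : (game N).Attracted (S.verts N) c.opp A (.s c m j.succ)) :
    (game N).Attracted (S.verts N) c.opp A (.b c m j) :=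
  .own (Shape.mem_b.mpr ⟨hm, hj⟩) rfl (.b_s ..) hs

theorem attracted_l (hm : S.low c m)
    (ht : (game N).Attracted (S.verts N) α A (.t c m)) :
    (game N).Attracted (S.verts N) α A (.l c m) := by
  have : α = c.opp ∨ α.opp = c.opp := by cases α <;> cases c <;> decide
  rcases this with rfl | h
  · exact .own (Shape.mem_l.mpr hm) rfl (.l_t ..) ht
  · refine .opponent (Shape.mem_l.mpr hm) h.symm fun w hw he => ?_
    cases he with
    | l_t => exact ht

/-- The last vertex of the path of a bit is attracted by the opponent of its owner if all vertices
that it leads to are. -/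
theorem attracted_z (hm : S.tangle c m)
    (ht : (game N).Attracted (S.verts N) c.opp A (.t c m))
    (hl : ∀ i : Fin N, (m < i ∨ (c = .odd ∧ i = m)) → S.low c.opp i →
      (game N).Attracted (S.verts N) c.opp A (.l c.opp i)) :
    (game N).Attracted (S.verts N) c.opp A (.s c m (Fin.last m)) := by
  refine .opponent (Shape.mem_s.mpr hm) (by simp [owner]) fun w hw he => ?_
  generalize hq : Fin.last _ = q at he
  cases he with
  | s_a => exact absurd hq.symm (Fin.castSucc_ne_last _)
  | s_b => exact absurd hq.symm (Fin.castSucc_ne_last _)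
  | z_t => exact ht
  | z_l _ _ i h => exact hl i (.inl h) (Shape.mem_l.mp hw)
  | z_same => exact hl _ (.inr ⟨rfl, rfl⟩) (Shape.mem_l.mp hw)

end Paths

theorem top_tangles {N : ℕ} {c : Player} {T x : ℕ → Prop} (m : Fin N) (hm : T m) :
    Vertex.t c m ∈ (tangles c T x).verts N ∧
    ∀ w ∈ (tangles c T x).verts N, priority w ≤ priority (Vertex.t c m) := by
  refine ⟨by simp [tangles, hm], fun w hw => ?_⟩
  cases w <;> simp [tangles] at hw <;> simp [priority, hw]

theorem closed_tangles (c : Player) (T x : ℕ → Prop) : (tangles c T x).Closed :=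
  ⟨fun _ _ h => h.elim, fun _ _ h => h.elim, fun _ _ j _ _ => em (x j)⟩

/-- Tangles of player `c` without any escapes are won by `c`. -/
theorem zielonka_tangles {N : ℕ} {c : Player} {T x : ℕ → Prop} (hT : ∃ m : Fin N, T m) :
    (game N).zielonka ((tangles c T x).verts N) =
      { win := fun β => if β = c then (tangles c T x).verts N else ∅
        calls := 1, events := [] } := by
  obtain ⟨m, hm⟩ := hT
  obtain ⟨h1, h2⟩ := top_tangles (c := c) (x := x) m hm
  set S := (tangles c T x).verts N with hS
  have hA : (game N).attr S c ((game N).top S) = S \ ∅ := by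
    refine attr_eq_sdiff (fun v hv _ => ?_) (by simp) (by simp) (by simp)
    have ht : ∀ i : Fin N, T i → (game N).Attracted S c ((game N).top S) (.t c i) := fun i hi => by
      have : Vertex.t c i ∈ S := by simp [S, tangles, hi]
      refine .base this (Finset.mem_filter.mpr ⟨this, ?_⟩)
      rw [sup_priority_eq h1 h2]
      rfl
    have hs : ∀ i : Fin N, T i → ∀ j, (game N).Attracted S c ((game N).top S) (.s c i j) :=
      fun i hi => by
      refine attracted_s_own (by simp [tangles, hi]) (fun j => ?_) ?_
      · simpa [tangles] using em (x j)
      · exact .own (by simp [tangles, hi]) rfl (.z_t ..) (ht i hi)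
    cases v with
    | l d i => simp [hS, tangles] at hv
    | h d i => simp [hS, tangles] at hv
    | t d i =>
      obtain ⟨rfl, hi⟩ : d = c ∧ T i := by simpa [hS, tangles] using hv
      exact ht i hi
    | s d i j =>
      obtain ⟨rfl, hi⟩ : d = c ∧ T i := by simpa [hS, tangles] using hv
      exact hs i hi j
    | a d i j =>
      obtain ⟨⟨rfl, hi⟩, hj⟩ : (d = c ∧ T i) ∧ x j := by simpa [hS, tangles] using hv
      exact attracted_a_own (by simp [tangles, hi]) j hj (hs i hi _) (by simp [tangles])
    | b d i j =>
      obtain ⟨⟨rfl, hi⟩, hj⟩ : (d = c ∧ T i) ∧ ¬ x j := by simpa [hS, tangles] using hv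
      exact attracted_b_own (by simp [tangles, hi]) j hj (hs i hi _) (by simp [tangles])
  rw [zielonka_of_no_event h1 h2 (α := c)
    (by cases c <;> simp [priority, tanglePriority, Player.ofPriority]) (Finset.empty_subset _) hA]
  · simp [zielonka_empty]
  · rw [zielonka_empty, attr_empty]
    exact fun v hv => (closed_tangles c T x).exists_edge hv

/-! ### The attractors in the recursion -/

/-- The winner of a vertex of `sub k x P`. From a vertex `b` its owner, the opponent of the player
of the bit, can move to his own low vertex as long as that vertex is present. -/
def side {N : ℕ} (k : ℕ) : Vertex N → Player
  | .l c _ => c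
  | .t c _ => c
  | .h c _ => c
  | .s c _ _ => c
  | .a c _ _ => c
  | .b c _ j => if k ≤ j.val then c.opp else c

section Attractors

variable {N : ℕ} (k : Fin N) (x : ℕ → Prop) (P : Prop)

theorem closed_sub (k : ℕ) : (sub k x P).Closed :=
  ⟨fun _ _ h => h.elim, fun _ _ h => .inl h, fun c m j _ _ => by simp [sub]; tauto⟩

theorem closed_subOdd (k : ℕ) : (subOdd k x).Closed :=
  ⟨fun _ _ h => h.elim, fun _ _ h => h.1, fun c m j _ _ => by simp [subOdd]; grind⟩

theorem closed_subSet (k : ℕ) : (subSet k x P).Closed :=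
  ⟨fun _ _ h => h.elim, fun _ _ h => .inl h, fun c m j _ _ => by simp [subSet]; grind⟩

theorem subOdd_subset : (subOdd k x).verts N ⊆ (sub k x P).verts N := fun v hv => by
  cases v <;> simp [sub, subOdd] at hv ⊢ <;> tauto

/-- The vertices `a` at position `k` of Odd are Even's and lead to `l odd k`, and so does the last
vertex of the tangle in `P`. -/
theorem attr_low_odd :
    (game N).attr ((sub k x P).verts N) .even {.l .odd k} =
      (sub k x P).verts N \ (subOdd k x).verts N := by
  refine Shape.attr_eq_sdiff (closed_subOdd x k) (subOdd_subset ..) ?_ ?_ ?_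
  · have hl : (game N).Attracted ((sub k x P).verts N) .even {.l .odd k} (.l .odd k) :=
      .base (by simp [sub]) (by simp)
    have hs : ∀ m : Fin N, P → m.val + 1 = k → ∀ j,
        (game N).Attracted ((sub k x P).verts N) .even {.l .odd k} (.s .even m j) :=
      fun m hP hm => attracted_s_own (by simp [sub, hP, hm])
        (fun j => by
          have hj : ¬ k.val ≤ j.val := by have := j.isLt; omega
          simpa [sub, hj] using em (x j))
        (.own (by simp [sub, hP, hm]) rfl (.z_l _ _ k (by rw [Fin.lt_def]; omega)) hl)
    intro v hv hv'
    cases v with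
    | l d i =>
      obtain ⟨rfl, rfl⟩ : d = .odd ∧ i = k := by
        simp [sub, subOdd] at hv hv'; grind
      exact hl
    | h d i => simp [sub] at hv
    | t d i =>
      obtain ⟨hP, rfl, hi⟩ : P ∧ d = .even ∧ i.val + 1 = k := by
        simp [sub, subOdd] at hv hv'; grind
      exact attracted_t_own (by simp [sub, hP, hi]) (by simp [sub]) (hs i hP hi _)
    | s d i j =>
      obtain ⟨hP, rfl, hi⟩ : P ∧ d = .even ∧ i.val + 1 = k := by
        simp [sub, subOdd] at hv hv'; grind
      exact hs i hP hi _
    | a d i j =>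
      have : (P ∧ d = .even ∧ i.val + 1 = k) ∨ (d = .odd ∧ j.val = k) := by
        simp [sub, subOdd] at hv hv'; grind
      rcases this with ⟨hP, rfl, hi⟩ | ⟨rfl, hj⟩
      · exact attracted_a_own (Shape.mem_a.mp hv).1 j (Shape.mem_a.mp hv).2 (hs i hP hi _)
          (fun h => by simp [sub] at h; omega)
      · exact .own hv rfl (.a_l ..) (by simpa [hj] using hl)
    | b d i j =>
      obtain ⟨hP, rfl, hi⟩ : P ∧ d = .even ∧ i.val + 1 = k := by
        simp [sub, subOdd] at hv hv'; grind
      exact attracted_b_own (Shape.mem_b.mp hv).1 j (Shape.mem_b.mp hv).2 (hs i hP hi _)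
          (fun h => by simp [sub] at h; omega)
  · intro v hv
    cases v <;> simp [subOdd] at hv ⊢
    grind
  · intro v w he hv ho hw
    cases he <;> simp [subOdd, sub, owner] at hv ho hw ⊢ <;> grind

/-- The game on the bits below bit `k` that is solved before bit `k` has been set: the vertices `b`
are left at position `k`, and the tangle of bit `k` of Even is present. -/
abbrev subUnset (k : ℕ) (x : ℕ → Prop) : Shape := sub (k + 1) (fun j => x j ∧ j ≠ k) True

/-- The game on the bits below bit `k` that is solved after bit `k` has been set: the vertices `a`
are left at position `k`. -/
abbrev subNext (k : ℕ) (x : ℕ → Prop) : Shape := sub (k + 1) (fun j => x j ∨ j = k) False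

/-- The tangle of bit `k` of Odd, with the positions of its path given by `x`. -/
abbrev tangleOdd (k : ℕ) (x : ℕ → Prop) : Shape := tangles .odd (fun m => m = k) x

/-- The tangle of bit `k` of Even and, if `P` holds, that of bit `k - 1`. -/
abbrev tanglesEven (k : ℕ) (x : ℕ → Prop) (P : Prop) : Shape :=
  tangles .even (fun m => m = k ∨ (P ∧ m + 1 = k)) x

theorem subUnset_subset : (subUnset k x).verts N ⊆ (subOdd k x).verts N := fun v hv => by
  cases v <;> simp [sub, subOdd] at hv ⊢ <;> grind

theorem tangleOdd_subset : (tangleOdd k x).verts N ⊆ (subOdd k x).verts N := fun v hv => by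
  cases v <;> simp [tangles, subOdd] at hv ⊢ <;> grind

theorem subSet_subset : (subSet k x P).verts N ⊆ (sub k x P).verts N := fun v hv => by
  cases v <;> simp [sub, subSet] at hv ⊢ <;> grind

theorem tanglesEven_subset : (tanglesEven k x P).verts N ⊆ (subSet k x P).verts N := fun v hv => by
  cases v <;> simp [tangles, subSet] at hv ⊢ <;> grind

theorem subNext_subset : (subNext k x).verts N ⊆ (subSet k x P).verts N := fun v hv => by
  cases v <;> simp [sub, subSet] at hv ⊢ <;> grind

/-- The last vertex of the tangle of bit `k` of Odd leads to `l even k`; the path to it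
cannot be left, because the low vertices of the higher bits are absent. -/
theorem attr_low_even :
    (game N).attr ((subOdd k x).verts N) .odd {.l .even k} =
      (subOdd k x).verts N \ (subUnset k x).verts N := by
  refine Shape.attr_eq_sdiff (closed_sub _ _ _) (subUnset_subset ..) ?_ ?_ ?_
  · have hl : (game N).Attracted ((subOdd k x).verts N) .odd {.l .even k} (.l .even k) :=
      .base (by simp [subOdd]) (by simp)
    have hs : ∀ j, (game N).Attracted ((subOdd k x).verts N) .odd {.l .even k} (.s .odd k j) :=
      attracted_s_own (by simp [subOdd])
        (fun j => by
          have hj : ¬ k.val ≤ j.val ∧ j.val ≠ k := by have := j.isLt; omega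
          simpa [subOdd, hj] using em (x j))
        (.own (by simp [subOdd]) rfl (.z_same _) hl)
    intro v hv hv'
    cases v with
    | l d i =>
      obtain ⟨rfl, rfl⟩ : d = .even ∧ i = k := by
        cases d <;> simp [sub, subOdd] at hv hv' ⊢ <;> grind
      exact hl
    | h d i => simp [subOdd] at hv
    | t d i =>
      obtain ⟨rfl, rfl⟩ : d = .odd ∧ i = k := by
        cases d <;> simp [sub, subOdd] at hv hv' ⊢ <;> grind
      exact attracted_t_own (Shape.mem_t.mp hv) (by simp [subOdd]) (hs _)
    | s d i j =>
      obtain ⟨rfl, rfl⟩ : d = .odd ∧ i = k := by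
        cases d <;> simp [sub, subOdd] at hv hv' ⊢ <;> grind
      exact hs _
    | a d i j =>
      have : (d = .odd ∧ i = k) ∨ (d = .even ∧ j.val = k) := by
        cases d <;> simp [sub, subOdd] at hv hv' ⊢ <;> grind
      rcases this with ⟨rfl, rfl⟩ | ⟨rfl, hj⟩
      · exact attracted_a_own (Shape.mem_a.mp hv).1 j (Shape.mem_a.mp hv).2 (hs _)
          (fun h => by simp [subOdd] at h; omega)
      · exact .own hv rfl (.a_l ..) (by simpa [hj] using hl)
    | b d i j =>
      obtain ⟨rfl, rfl⟩ : d = .odd ∧ i = k := by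
        cases d <;> simp [sub, subOdd] at hv hv' ⊢ <;> grind
      exact attracted_b_own (Shape.mem_b.mp hv).1 j (Shape.mem_b.mp hv).2 (hs _)
          (fun h => by simp [subOdd] at h; omega)
  · intro v hv
    cases v <;> simp [sub] at hv ⊢
    grind
  · intro v w he hv ho hw
    cases he <;> simp [subOdd, sub, owner] at hv ho hw ⊢ <;> grind

/-- Besides `l odd k` Odd attracts the vertices `b` of Even that lead to it. -/
theorem attr_tangleOdd :
    (game N).attr ((sub k x P).verts N) .odd ((tangleOdd k x).verts N) =
      (sub k x P).verts N \ (subSet k x P).verts N := by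
  refine Shape.attr_eq_sdiff (closed_subSet _ _ _) (subSet_subset ..) ?_ ?_ ?_
  · have ht : ∀ v ∈ (tangleOdd k x).verts N, (game N).Attracted ((sub k x P).verts N) .odd
        ((tangleOdd k x).verts N) v :=
      fun v hv => .base (subOdd_subset _ _ _ (tangleOdd_subset _ _ hv)) hv
    have hl : (game N).Attracted ((sub k x P).verts N) .odd ((tangleOdd k x).verts N)
        (.l .odd k) :=
      attracted_l (by simp [sub]) (ht _ (by simp [tangles]))
    intro v hv hv'
    cases v with
    | l d i =>
      obtain ⟨rfl, rfl⟩ : d = .odd ∧ i = k := by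
        cases d <;> simp [sub, subSet] at hv hv' ⊢ <;> grind
      exact hl
    | h d i => simp [sub] at hv
    | t d i =>
      obtain ⟨rfl, rfl⟩ : d = .odd ∧ i = k := by
        cases d <;> simp [sub, subSet] at hv hv' ⊢ <;> grind
      exact ht _ (by simp [tangles])
    | s d i j =>
      obtain ⟨rfl, rfl⟩ : d = .odd ∧ i = k := by
        cases d <;> simp [sub, subSet] at hv hv' ⊢ <;> grind
      exact ht _ (by simp [tangles])
    | a d i j =>
      obtain ⟨rfl, rfl⟩ : d = .odd ∧ i = k := by
        cases d <;> simp [sub, subSet] at hv hv' ⊢ <;> grind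
      exact ht _ (by simp [tangles, sub] at hv ⊢; grind)
    | b d i j =>
      have : (d = .odd ∧ i = k) ∨ (d = .even ∧ j.val = k) := by
        cases d <;> simp [sub, subSet] at hv hv' ⊢ <;> grind
      rcases this with ⟨rfl, rfl⟩ | ⟨rfl, hj⟩
      · exact ht _ (by simp [tangles, sub] at hv ⊢; grind)
      · exact .own hv rfl (.b_l ..) (by simpa [hj] using hl)
  · intro v hv
    cases v <;> simp [tangles, subSet] at hv ⊢ <;> grind
  · intro v w he hv ho hw
    cases he <;> simp [subSet, sub, owner] at hv ho hw ⊢ <;> grind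

/-- Besides `l even k` Even attracts the vertices `b` of Odd that lead to it. What remains is the
game on the lower bits in which only the vertices `a` are left at position `k`. -/
theorem attr_tanglesEven :
    (game N).attr ((subSet k x P).verts N) .even ((tanglesEven k x P).verts N) =
      (subSet k x P).verts N \ (subNext k x).verts N := by
  refine Shape.attr_eq_sdiff (closed_sub _ _ _) (subNext_subset ..) ?_ ?_ ?_
  · have ht : ∀ v ∈ (tanglesEven k x P).verts N, (game N).Attracted ((subSet k x P).verts N) .even
        ((tanglesEven k x P).verts N) v :=
      fun v hv => .base (tanglesEven_subset _ _ _ hv) hv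
    have hl : (game N).Attracted ((subSet k x P).verts N) .even ((tanglesEven k x P).verts N)
        (.l .even k) :=
      attracted_l (by simp [subSet]) (ht _ (by simp [tangles]))
    intro v hv hv'
    by_cases hv2 : v ∈ (tanglesEven k x P).verts N
    · exact ht v hv2
    cases v with
    | l d i =>
      obtain ⟨rfl, rfl⟩ : d = .even ∧ i = k := by
        cases d <;> simp [sub, subSet] at hv hv' ⊢ <;> grind
      exact hl
    | b d i j =>
      obtain ⟨rfl, hj⟩ : d = .odd ∧ j.val = k := by
        cases d <;> simp [sub, subSet, tangles] at hv hv' hv2 ⊢ <;> grind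
      exact .own hv rfl (.b_l ..) (by simpa [hj] using hl)
    | h d i => simp [subSet] at hv
    | t d i =>
      cases d <;> simp [sub, subSet, tangles] at hv hv' hv2 <;> grind
    | s d i j =>
      cases d <;> simp [sub, subSet, tangles] at hv hv' hv2 <;> grind
    | a d i j =>
      cases d <;> simp [sub, subSet, tangles] at hv hv' hv2 <;> grind
  · intro v hv
    cases v <;> simp [tangles, sub] at hv ⊢ <;> grind
  · intro v w he hv ho hw
    cases he <;> simp [subSet, sub, owner] at hv ho hw ⊢ <;> grind

/-- Even attracts `l even k` from her tangle, with it the vertices `b` at position `k` of the paths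
of Odd, and then the lower bits of Odd altogether, whose paths cannot avoid these vertices. -/
theorem attr_win_even :
    (game N).attr ((subOdd k x).verts N) .even
        (((subUnset k x).verts N).filter fun v => side (k + 1) v = .even) =
      (subOdd k x).verts N \ (tangleOdd k x).verts N := by
  refine Shape.attr_eq_sdiff (closed_tangles _ _ _) (tangleOdd_subset ..) ?_ ?_ ?_
  · set W := ((subUnset k x).verts N).filter fun v => side (k + 1) v = .even with hW
    have hb : ∀ v ∈ W, (game N).Attracted ((subOdd k x).verts N) .even W v := fun v hv =>
      .base (subUnset_subset _ _ (Finset.mem_filter.mp hv).1) hv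
    have htE : ∀ i : Fin N, k ≤ i →
        (game N).Attracted ((subOdd k x).verts N) .even W (.t .even i) := fun i hi =>
      hb _ (by simp [hW, sub, side]; grind)
    have hsE : ∀ i : Fin N, k ≤ i → ∀ j,
        (game N).Attracted ((subOdd k x).verts N) .even W (.s .even i j) := fun i hi j =>
      hb _ (by simp [hW, sub, side]; grind)
    have hlE : ∀ i : Fin N, k ≤ i →
        (game N).Attracted ((subOdd k x).verts N) .even W (.l .even i) := fun i hi =>
      attracted_l (by simpa [subOdd] using hi) (htE i hi)
    have hbO : ∀ i : Fin N, ∀ h : k < i,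
        (game N).Attracted ((subOdd k x).verts N) .even W (.b .odd i ⟨k, h⟩) := fun i hi =>
      .own (by simp [subOdd]; grind) rfl (.b_l ..) (hlE k le_rfl)
    -- The vertex `a` at position `k` is gone, so Odd has to walk into the attractor there.
    have hskO : ∀ i : Fin N, ∀ h : k < i, (game N).Attracted ((subOdd k x).verts N) .even W
        (.s .odd i (Fin.castSucc ⟨k, h⟩)) := fun i hi => by
      refine .opponent (by simp [subOdd]; grind) rfl fun w hw he => ?_
      generalize hq : Fin.castSucc _ = q at he
      cases he with
      | s_a =>
        cases Fin.castSucc_injective _ hq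
        simp [subOdd] at hw
      | s_b =>
        cases Fin.castSucc_injective _ hq
        exact hbO i hi
      | z_t => exact absurd hq (Fin.castSucc_ne_last _)
      | z_l => exact absurd hq (Fin.castSucc_ne_last _)
      | z_same => exact absurd hq (Fin.castSucc_ne_last _)
    have htO : ∀ i : Fin N, k < i →
        (game N).Attracted ((subOdd k x).verts N) .even W (.t .odd i) := fun i hi =>
      have hi' : (subOdd k x).tangle .odd i := hi.le
      attracted_t_opp (c := .odd) hi' (attracted_s_opp hi' (hskO i hi) 0 (Fin.zero_le _))
    have hlO : ∀ i : Fin N, k < i →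
        (game N).Attracted ((subOdd k x).verts N) .even W (.l .odd i) := fun i hi =>
      attracted_l (by simp [subOdd]; grind) (htO i hi)
    have hsO : ∀ i : Fin N, k < i → ∀ j,
        (game N).Attracted ((subOdd k x).verts N) .even W (.s .odd i j) := fun i hi j =>
      have hi' : (subOdd k x).tangle .odd i := hi.le
      attracted_s_opp (c := .odd) hi' (attracted_z (c := .odd) hi' (htO i hi) fun i' h _ =>
        hlE i' (by rcases h with h | ⟨_, rfl⟩ <;> [exact (hi.trans h).le; exact hi.le])) j
        (Fin.le_last j)
    intro v hv hv'
    have hcase : ∀ (d : Player) (i : Fin N), k.val ≤ i.val → ¬ (d = .odd ∧ i.val = k.val) →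
        (d = .even ∧ k ≤ i) ∨ (d = .odd ∧ k < i) := by
      intro d i h1 h2
      rw [Fin.le_def, Fin.lt_def]
      cases d <;> simp at h2 ⊢ <;> omega
    cases v with
    | l d i =>
      simp only [Shape.mem_l, subOdd] at hv
      rcases hcase d i hv.1 hv.2 with ⟨rfl, h⟩ | ⟨rfl, h⟩
      · exact hlE i h
      · exact hlO i h
    | h d i => simp [subOdd] at hv
    | t d i =>
      simp [subOdd, tangles] at hv hv'
      rcases hcase d i hv (by tauto) with ⟨rfl, h⟩ | ⟨rfl, h⟩
      · exact htE i h
      · exact htO i h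
    | s d i j =>
      simp [subOdd, tangles] at hv hv'
      rcases hcase d i hv (by tauto) with ⟨rfl, h⟩ | ⟨rfl, h⟩
      · exact hsE i h j
      · exact hsO i h j
    | a d i j =>
      have hm := Shape.mem_a.mp hv
      rcases hcase d i hm.1 (by simp [subOdd, tangles] at hv hv'; grind) with ⟨rfl, h⟩ | ⟨rfl, h⟩
      · exact attracted_a_own hm.1 j hm.2 (hsE i h _) fun h' => hlE _ h'.1
      · exact attracted_a_opp (c := .odd) hm.1 j hm.2 (hsO i h _)
    | b d i j =>
      have hm := Shape.mem_b.mp hv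
      rcases hcase d i hm.1 (by simp [subOdd, tangles] at hv hv'; grind) with ⟨rfl, h⟩ | ⟨rfl, h⟩
      · refine attracted_b_own hm.1 j hm.2 (hsE i h _) fun h' => hlO _ ?_
        have := h'.1
        have := h'.2
        rw [Fin.lt_def]
        simp at *
        omega
      · exact attracted_b_opp (c := .odd) hm.1 j hm.2 (hsO i h _)
  · intro v hv
    cases v <;> simp [tangles, sub, side] at hv ⊢ <;> grind
  · intro v w he hv ho hw
    cases he <;> simp [subOdd, tangles, owner] at hv ho hw ⊢ <;> grind

/-- From `l even k` Odd attracts the lower bits of Even, whose paths cannot avoid the vertices `a`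
at position `k`, and then the lower bits of Odd, whose last vertices lead to low vertices of Even. -/
theorem attr_low_even_of_set :
    (game N).attr ((subSet k x P).verts N) .odd {.l .even k} =
      (subSet k x P).verts N \ (tanglesEven k x P).verts N := by
  refine Shape.attr_eq_sdiff (closed_tangles _ _ _) (tanglesEven_subset ..) ?_ ?_ ?_
  · set W : Finset (Vertex N) := {.l .even k} with hW
    have hT : ∀ c, ∀ i : Fin N, k < i → (subSet k x P).tangle c i := fun c i hi => by
      simp [subSet]; grind
    have hlE0 : (game N).Attracted ((subSet k x P).verts N) .odd W (.l .even k) :=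
      .base (by simp [subSet]) (by simp [hW])
    -- The vertex `b` at position `k` is gone, so Even has to walk into the attractor there.
    have hskE : ∀ i : Fin N, ∀ h : k < i, (game N).Attracted ((subSet k x P).verts N) .odd W
        (.s .even i (Fin.castSucc ⟨k, h⟩)) := fun i hi => by
      refine .opponent (Shape.mem_s.mpr (hT _ i hi)) rfl fun w hw he => ?_
      generalize hq : Fin.castSucc _ = q at he
      cases he with
      | s_a =>
        cases Fin.castSucc_injective _ hq
        exact .own hw rfl (.a_l ..) hlE0
      | s_b =>
        cases Fin.castSucc_injective _ hq
        simp [subSet] at hw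
      | z_t => exact absurd hq (Fin.castSucc_ne_last _)
      | z_l => exact absurd hq (Fin.castSucc_ne_last _)
    have htE : ∀ i : Fin N, k < i →
        (game N).Attracted ((subSet k x P).verts N) .odd W (.t .even i) := fun i hi =>
      attracted_t_opp (c := .even) (hT _ i hi)
        (attracted_s_opp (c := .even) (hT _ i hi) (hskE i hi) 0 (Fin.zero_le _))
    have hlE : ∀ i : Fin N, k ≤ i →
        (game N).Attracted ((subSet k x P).verts N) .odd W (.l .even i) := fun i hi => by
      rcases hi.eq_or_lt with rfl | hi
      · exact hlE0
      · exact attracted_l (by simp [subSet]; grind) (htE i hi)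
    have hsO : ∀ i : Fin N, k < i → ∀ j,
        (game N).Attracted ((subSet k x P).verts N) .odd W (.s .odd i j) := fun i hi j =>
      attracted_s_own (hT _ i hi) (fun j => by
          by_cases hj : k.val ≤ j.val
          · exact .inr ⟨by simp [subSet, hj], fun _ => hlE _ hj⟩
          · simpa [subSet, hj] using em (x j))
        (.own (Shape.mem_s.mpr (hT _ i hi)) rfl (.z_same ..) (hlE i hi.le)) j
    have htO : ∀ i : Fin N, k < i →
        (game N).Attracted ((subSet k x P).verts N) .odd W (.t .odd i) := fun i hi =>
      attracted_t_own (hT _ i hi) (by simp [subSet]) (hsO i hi 0)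
    have hlO : ∀ i : Fin N, k < i →
        (game N).Attracted ((subSet k x P).verts N) .odd W (.l .odd i) := fun i hi =>
      attracted_l (by simp [subSet]; grind) (htO i hi)
    have hsE : ∀ i : Fin N, k < i → ∀ j,
        (game N).Attracted ((subSet k x P).verts N) .odd W (.s .even i j) := fun i hi j =>
      attracted_s_opp (c := .even) (hT _ i hi) (attracted_z (c := .even) (hT _ i hi) (htE i hi)
        fun i' h _ => hlO i' (by rcases h with h | ⟨h, _⟩ <;> [exact hi.trans h; cases h])) j
        (Fin.le_last j)
    intro v hv hv'
    cases v with
    | l d i =>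
      have hi := (Shape.mem_l.mp hv).1
      cases d with
      | even => exact hlE i hi
      | odd =>
        have := (Shape.mem_l.mp hv).2
        exact hlO i (by rw [Fin.lt_def]; simp at this; omega)
    | h d i => simp [subSet] at hv
    | t d i =>
      have hi : k < i := by
        rw [Fin.lt_def]; cases d <;> simp [subSet, tangles] at hv hv' <;> grind
      cases d <;> [exact htE i hi; exact htO i hi]
    | s d i j =>
      have hi : k < i := by
        rw [Fin.lt_def]; cases d <;> simp [subSet, tangles] at hv hv' <;> grind
      cases d <;> [exact hsE i hi j; exact hsO i hi j]
    | a d i j =>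
      have hm := Shape.mem_a.mp hv
      have hi : k < i := by
        rw [Fin.lt_def]; cases d <;> simp [subSet, tangles] at hv hv' <;> grind
      cases d with
      | even => exact attracted_a_opp (c := .even) hm.1 j hm.2 (hsE i hi _)
      | odd =>
        refine attracted_a_own hm.1 j hm.2 (hsO i hi _) fun h' => hlO _ ?_
        have := h'.1
        have := h'.2
        rw [Fin.lt_def]
        simp at *
        omega
    | b d i j =>
      have hm := Shape.mem_b.mp hv
      have hi : k < i := by
        rw [Fin.lt_def]; cases d <;> simp [subSet, tangles] at hv hv' <;> grind
      cases d with
      | even => exact attracted_b_opp (c := .even) hm.1 j hm.2 (hsE i hi _)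
      | odd => exact attracted_b_own hm.1 j hm.2 (hsO i hi _) fun h' => hlE _ h'.1
  · intro v hv
    cases v <;> simp [tangles] at hv ⊢
  · intro v w he hv ho hw
    cases he <;> simp [subSet, tangles, owner] at hv ho hw ⊢ <;> grind

end Attractors

/-! ### The recursion -/

/-- The vertices of a shape that player `c` wins according to `side k`. -/
noncomputable def Shape.won (N : ℕ) (S : Shape) (k : ℕ) (c : Player) : Finset (Vertex N) :=
  (S.verts N).filter fun v => side k v = c

@[simp] theorem Shape.mem_won {N : ℕ} {S : Shape} {k : ℕ} {c : Player} {v : Vertex N} :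
    v ∈ S.won N k c ↔ v ∈ S.verts N ∧ side k v = c := Finset.mem_filter

section Recursion

variable {N : ℕ} (k : Fin N) (x : ℕ → Prop) (P : Prop)

/-- The part of the solution of `sub k x P` that ends with the first event of the round. -/
theorem zielonka_subOdd {n : ℕ} {es : List (Event (Vertex N))}
    (h : (game N).zielonka ((subUnset k x).verts N) =
      { win := (subUnset k x).won N (k + 1), calls := n, events := es }) :
    (game N).zielonka ((subOdd k x).verts N) =
      { win := fun β => if β = .even then (subOdd k x).verts N \ (tangleOdd k x).verts N
          else (tangleOdd k x).verts N
        calls := n + 2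
        events := es ++ [⟨{.l .even k}, (tangleOdd k x).verts N⟩] } := by
  have hT := zielonka_tangles (N := N) (c := .odd) (T := fun m => m = k) (x := x) ⟨k, rfl⟩
  rw [zielonka_of_event (v := .l .even k) (α := .odd) (R := (subUnset k x).verts N)
    (R' := (tangleOdd k x).verts N) (by simp [subOdd]) ?_ ?_ (subUnset_subset ..)
    (attr_low_even k x) ?_ (tangleOdd_subset ..) ?_ (by simp [tangles]), h, hT]
  · simp only [Run.mk.injEq, and_true]
    funext β
    cases β <;> simp
  · intro w hw hne
    cases w with
    | l c m =>
      cases c <;> simp [subOdd, priority, lowPriority] at hw hne ⊢ <;> grind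
    | h c m => simp [subOdd] at hw
    | _ c => cases c <;> simp [priority, lowPriority, tanglePriority] <;> omega
  · simp [priority, lowPriority, Player.ofPriority]
  · rw [h]; simp [sub, side]
  · rw [h]; exact attr_win_even k x

/-- The part of the solution of `sub k x P` that begins with the third event of the round. -/
theorem zielonka_subSet {n : ℕ} {es : List (Event (Vertex N))}
    (h : (game N).zielonka ((subNext k x).verts N) =
      { win := (subNext k x).won N (k + 1), calls := n, events := es }) :
    (game N).zielonka ((subSet k x P).verts N) =
      { win := fun β => if β = .even then (subNext k x).won N (k + 1) .even ∪
            (subSet k x P).verts N \ (subNext k x).verts N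
          else (subNext k x).won N (k + 1) .odd
        calls := n + 2
        events := ⟨{.l .even k}, (subNext k x).verts N⟩ :: es } := by
  have hT := zielonka_tangles (N := N) (c := .even)
    (T := fun m => m = k ∨ (P ∧ m + 1 = k)) (x := x) ⟨k, .inl rfl⟩
  rw [zielonka_of_event (v := .l .even k) (α := .odd) (R := (tanglesEven k x P).verts N)
    (R' := (subNext k x).verts N) (by simp [subSet]) ?_ ?_ (tanglesEven_subset ..)
    (attr_low_even_of_set k x P) ?_ (subNext_subset ..) ?_ (by simp [sub]), h, hT]
  · simp only [List.nil_append, Run.mk.injEq, and_true]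
    constructor
    · funext β
      cases β <;> simp
    · omega
  · intro w hw hne
    cases w with
    | l c m =>
      cases c <;> simp [subSet, priority, lowPriority] at hw hne ⊢ <;> grind
    | h c m => simp [subSet] at hw
    | _ c => cases c <;> simp [priority, lowPriority, tanglePriority] <;> omega
  · simp [priority, lowPriority, Player.ofPriority]
  · rw [hT]; simp [tangles]
  · rw [hT]; simpa using attr_tanglesEven k x P

/-- The winning regions of `sub k x P` in terms of those of `subNext k x`, as the algorithm composes
them. -/
theorem won_sub (c : Player) :
    (sub k x P).won N k c = if c = .odd then
        (subNext k x).won N (k + 1) .odd ∪ (sub k x P).verts N \ (subSet k x P).verts N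
      else (subNext k x).won N (k + 1) .even ∪
        (subSet k x P).verts N \ (subNext k x).verts N := by
  ext v
  cases c <;>
    rcases v with ⟨_ | _, _⟩ | ⟨_ | _, _⟩ | ⟨_ | _, _⟩ | ⟨_ | _, _, _⟩ | ⟨_ | _, _, _⟩ |
      ⟨_ | _, _, _⟩ <;>
    simp [sub, subSet, side] <;> grind

theorem zielonka_sub_step {n n' : ℕ} {es es' : List (Event (Vertex N))}
    (h : (game N).zielonka ((subUnset k x).verts N) =
      { win := (subUnset k x).won N (k + 1), calls := n, events := es })
    (h' : (game N).zielonka ((subNext k x).verts N) =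
      { win := (subNext k x).won N (k + 1), calls := n', events := es' }) :
    (game N).zielonka ((sub k x P).verts N) =
      { win := (sub k x P).won N k
        calls := n + n' + 5
        events := es ++ ⟨{.l .even k}, (tangleOdd k x).verts N⟩ ::
          ⟨{.l .odd k}, (subSet k x P).verts N⟩ ::
          ⟨{.l .even k}, (subNext k x).verts N⟩ :: es' } := by
  have h1 := zielonka_subOdd k x h
  have h2 := zielonka_subSet k x P h'
  rw [zielonka_of_event (v := .l .odd k) (α := .even) (R := (subOdd k x).verts N)
    (R' := (subSet k x P).verts N) (by simp [sub]) ?_ ?_ (subOdd_subset ..)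
    (attr_low_odd k x P) ?_ (subSet_subset ..) ?_ (by simp [subSet]), h1, h2]
  · simp only [List.append_assoc, List.cons_append, List.nil_append, Run.mk.injEq, and_true]
    constructor
    · funext β
      rw [won_sub]
      cases β <;> simp
    · omega
  · intro w hw hne
    cases w with
    | l c m =>
      cases c <;> simp [sub, priority, lowPriority] at hw hne ⊢ <;> grind
    | h c m => simp [sub] at hw
    | _ c => cases c <;> simp [priority, lowPriority, tanglePriority]
  · simp [priority, lowPriority, Player.ofPriority]
  · rw [h1]; simp [tangles]
  · rw [h1]; simpa using attr_tangleOdd k x P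

end Recursion

/-- Event lists of a binary counter on the bits from `k` on: both counters first count through the
lower bits, then bit `k` of Even, of Odd and of Even again is identified, where the second
identification resets bit `k` of Even and the lower bits of both counters, and finally both counters
go through the lower bits again. Only the low vertices in the recomputed subgames matter. -/
inductive Counts (N : ℕ) : ℕ → List (Event (Vertex N)) → Prop
  | nil : Counts N N []
  | step (k : Fin N) {es es' : List (Event (Vertex N))} {R₁ R₂ R₃ : Finset (Vertex N)} :
      Counts N (k + 1) es → Counts N (k + 1) es' →
      (∀ c m, .l c m ∉ R₁) →
      (∀ c m, .l c m ∈ R₂ ↔ k ≤ m ∧ ¬ (c = .odd ∧ m = k)) →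
      (∀ c m, .l c m ∈ R₃ ↔ k < m) →
      Counts N k (es ++ ⟨{.l .even k}, R₁⟩ :: ⟨{.l .odd k}, R₂⟩ :: ⟨{.l .even k}, R₃⟩ :: es')

theorem sub_self_verts (N : ℕ) (x : ℕ → Prop) (P : Prop) :
    (sub N x P).verts N = (tangles .even (fun m => P ∧ m + 1 = N) x).verts N := by
  ext v
  cases v <;> simp [sub, tangles] <;> grind

/-- The solution of `sub k x P`, with the exact number of calls, where `d = N - k` bits are left. In
the case `d = 0` the tangle in `P` takes one call, if it is present. -/
theorem zielonka_sub {N : ℕ} (hN : 0 < N) (d k : ℕ) (hk : k + d = N) (x : ℕ → Prop) (P : Prop) :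
    ∃ n es, Counts N k es ∧
      (d = 0 → (P → n = 1) ∧ (¬ P → n = 0)) ∧ (∀ e, d = e + 1 → n + 5 = 11 * 2 ^ e) ∧
      (game N).zielonka ((sub k x P).verts N) =
        { win := (sub k x P).won N k, calls := n, events := es } := by
  induction d generalizing k x P with
  | zero =>
    obtain rfl : k = N := hk
    by_cases hP : P
    · refine ⟨1, [], .nil, by simp [hP], by simp, ?_⟩
      rw [sub_self_verts, zielonka_tangles ⟨⟨k - 1, by omega⟩, hP, by simp only; omega⟩,
        ← sub_self_verts]
      simp only [Run.mk.injEq, and_true]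
      funext β
      ext v
      cases β <;> cases v <;> simp [sub, side] <;> grind
    · refine ⟨0, [], .nil, by simp [hP], by simp, ?_⟩
      have h0 : (sub k x P).verts k = ∅ := by
        ext v
        cases v <;> simp [sub, hP]
      rw [h0, zielonka_empty]
      simp only [Run.mk.injEq, and_true]
      funext β
      simp [Shape.won, h0]
  | succ d ih =>
    obtain ⟨k, rfl⟩ : ∃ i : Fin N, k = i.val := ⟨⟨k, by omega⟩, rfl⟩
    obtain ⟨n, es, hes, hn0, hn1, h⟩ := ih (k + 1) (by omega) (fun j => x j ∧ j ≠ k) True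
    obtain ⟨n', es', hes', hn0', hn1', h'⟩ := ih (k + 1) (by omega) (fun j => x j ∨ j = k) False
    refine ⟨_, _, .step k hes hes' ?_ ?_ ?_, by simp, ?_, zielonka_sub_step k x P h h'⟩
    · simp [tangles]
    · simp [subSet, Fin.ext_iff]
    · simp [sub]
    · rintro e he
      obtain rfl : d = e := by omega
      cases d with
      | zero => simp at hn0 hn0' ⊢; omega
      | succ d =>
        have := hn1 d rfl
        have := hn1' d rfl
        rw [pow_succ]
        omega

/-- The whole game without the high vertices `h` of the bits `m < H c` of each player `c`. -/
def withHigh (H : Player → ℕ) : Shape where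
  low _ _ := True
  tangle _ _ := True
  high c m := H c ≤ m
  up _ _ := True
  down _ _ := True

theorem closed_withHigh (H : Player → ℕ) : (withHigh H).Closed :=
  ⟨fun _ _ _ _ => trivial, fun _ _ _ => trivial, fun _ _ _ _ _ => .inl trivial⟩

theorem withHigh_self (N : ℕ) (x : ℕ → Prop) (P : Prop) :
    (withHigh fun _ => N).verts N = (sub 0 x P).verts N := by
  ext v
  cases v <;> simp [withHigh, sub]

/-- The high vertices are not identified as distractions: their owners, the opponents of the players
of the bits, do not win the low vertices that they lead to. -/
theorem zielonka_withHigh_step {N : ℕ} (c : Player) (k : Fin N) (H H' : Player → ℕ)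
    (hc : H c = k) (hc' : H' c = k + 1) (ho : H' c.opp = H c.opp)
    (hlt : lowPriority N c.opp k < lowPriority N c k ∧ H c.opp = k ∨ H c.opp = k + 1)
    {n : ℕ} {es : List (Event (Vertex N))}
    (h : (game N).zielonka ((withHigh H').verts N) =
      { win := (withHigh H').won N 0
        calls := n, events := es }) :
    (game N).zielonka ((withHigh H).verts N) =
      { win := (withHigh H).won N 0
        calls := n + 1, events := es } := by
  have hmem : Vertex.h c k ∈ (withHigh H).verts N := by simp [withHigh, hc]
  have hsub : (withHigh H').verts N ⊆ (withHigh H).verts N := fun v hv => by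
    cases v <;> simp [withHigh] at hv ⊢
    rename_i d m
    rcases (by cases c <;> cases d <;> simp : d = c ∨ d = c.opp) with rfl | rfl <;> omega
  have hdiff : (withHigh H).verts N \ (withHigh H').verts N = {.h c k} := by
    ext v
    cases v <;> simp [withHigh]
    rename_i d m
    rcases (by cases c <;> cases d <;> simp : d = c ∨ d = c.opp) with rfl | rfl <;>
      simp [Fin.ext_iff] <;> omega
  have hiff : ∀ v, v ∈ (withHigh H).verts N ↔ v ∈ (withHigh H').verts N ∨ v = .h c k := by
    intro v
    rw [← Finset.mem_singleton, ← hdiff, ← Finset.mem_union, Finset.union_sdiff_of_subset hsub]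
  have hprio : ∀ w ∈ (withHigh H).verts N, w ≠ .h c k →
      priority w < priority (Vertex.h c k) := by
    intro w hw hne
    cases w with
    | h d m =>
      simp [withHigh] at hw
      simp [Fin.ext_iff] at hne
      cases c <;> cases d <;> simp [priority, lowPriority] at * <;> omega
    | l d m => cases c <;> cases d <;> simp [priority, lowPriority] <;> omega
    | _ d => cases c <;> cases d <;> simp [priority, lowPriority, tanglePriority] <;> omega
  have hnot : ∀ v ∈ (withHigh H').verts N, v ≠ .h c k := by
    rintro _ hv rfl
    simp [withHigh, hc'] at hv
  rw [zielonka_of_no_event (v := .h c k) (α := c) (R := (withHigh H').verts N) hmem ?_ ?_ hsub ?_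
    ?_, h]
  · simp only [Run.mk.injEq, and_true]
    funext β
    rw [hdiff]
    ext v
    have := hiff v
    split_ifs with hβ
    · simp only [Finset.mem_union, Shape.mem_won, Finset.mem_singleton, this]
      constructor
      · rintro (h | rfl)
        · exact ⟨.inl h.1, h.2⟩
        · exact ⟨.inr rfl, hβ.symm⟩
      · rintro ⟨h | h, h'⟩
        · exact .inl ⟨h, h'⟩
        · exact .inr h
    · simp only [Shape.mem_won, this]
      refine ⟨fun h => ⟨.inl h.1, h.2⟩, ?_⟩
      · rintro ⟨h | rfl, h'⟩
        · exact ⟨h, h'⟩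
        · exact absurd h'.symm hβ
  · intro w hw
    by_cases hwe : w = .h c k
    · rw [hwe]
    · exact (hprio w hw hwe).le
  · cases c
    · exact if_pos (by simp [priority, lowPriority]; omega)
    · exact if_neg (by simp [priority, lowPriority]; omega)
  · rw [top_eq_singleton hmem hprio]
    refine Shape.attr_eq_sdiff (closed_withHigh _) hsub ?_ ?_ ?_
    · intro v hv hv'
      have : v ∈ ({.h c k} : Finset (Vertex N)) := hdiff ▸ Finset.mem_sdiff.mpr ⟨hv, hv'⟩
      exact .base hv this
    · intro v hv
      rw [Finset.mem_singleton]
      exact hnot v hv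
    · intro v w he hv ho hw
      by_contra hw'
      have : w ∈ ({.h c k} : Finset (Vertex N)) := hdiff ▸ Finset.mem_sdiff.mpr ⟨hw, hw'⟩
      rw [Finset.mem_singleton] at this
      subst this
      cases he
      simp [owner] at ho
  · rw [h]
    have hW : (withHigh H').won N 0 c.opp =
        (withHigh H).verts N \ (withHigh H).won N 0 c := by
      ext v
      have := hiff v
      have hs : ∀ d : Player, d = c.opp ↔ d ≠ c := by cases c <;> rintro ⟨⟩ <;> simp
      simp only [Finset.mem_sdiff, Shape.mem_won, this, hs]
      refine ⟨fun h => ⟨.inl h.1, fun h' => h.2 h'.2⟩, ?_⟩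
      · rintro ⟨h | rfl, h'⟩
        · exact ⟨h, fun h'' => h' ⟨.inl h, h''⟩⟩
        · exact absurd ⟨.inr rfl, rfl⟩ h'
    simp only
    conv_rhs => rw [hW]
    refine ParityGame.attr_eq_sdiff ?_ ?_ ?_ ?_
    · intro v hv hv'
      refine .base hv ?_
      rw [hW]
      exact Finset.mem_sdiff.mpr ⟨hv, hv'⟩
    · intro v hv
      simp only [Shape.mem_won] at hv ⊢
      simp [hv.2]
    · intro v w hv ho hw he
      simp only [Shape.mem_won] at hv ⊢
      refine ⟨hw, ?_⟩
      replace hv := hv.2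
      cases he <;> simp [side, owner] at hv ho ⊢ <;> grind
    · intro v hv ho
      suffices ∃ w ∈ (withHigh H).verts N, side 0 w = c ∧ Edge v w by
        obtain ⟨w, hw, hs, he⟩ := this
        exact ⟨w, Shape.mem_won.mpr ⟨hw, hs⟩, hw, he⟩
      simp only [Shape.mem_won] at hv
      replace hv := hv.2
      cases v with
      | s d m j =>
        induction j using Fin.lastCases with
        | last => exact ⟨.t d m, by simp [withHigh], hv, .z_t ..⟩
        | cast j => exact ⟨.a d m j, by simp [withHigh], hv, .s_a ..⟩
      | b d m j => exact ⟨_, by simp [withHigh], by simpa [side] using hv, .b_l ..⟩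
      | _ d => simp [side, owner] at hv ho; simp [hv] at ho

/-- The high vertices are removed in the order of decreasing priority: bit by bit, and that of Odd
before that of Even. -/
theorem zielonka_withHigh {N : ℕ} (d k : ℕ) (hk : k + d = N) {n : ℕ}
    {es : List (Event (Vertex N))}
    (h : (game N).zielonka ((withHigh fun _ => N).verts N) =
      { win := (withHigh fun _ => N).won N 0
        calls := n, events := es }) :
    (game N).zielonka ((withHigh fun _ => k).verts N) =
      { win := (withHigh fun _ => k).won N 0
        calls := n + 2 * d, events := es } := by
  induction d generalizing k with
  | zero =>
    obtain rfl : k = N := hk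
    simpa using h
  | succ d ih =>
    obtain ⟨k, rfl⟩ : ∃ i : Fin N, k = i.val := ⟨⟨k, by omega⟩, rfl⟩
    have h1 := zielonka_withHigh_step .even k
      (fun c => if c = .even then k.val else k + 1) (fun _ => k + 1) rfl rfl rfl (.inr rfl)
      (ih (k + 1) (by omega))
    exact zielonka_withHigh_step .odd k (fun _ => k.val)
      (fun c => if c = .even then k.val else k + 1) rfl rfl rfl
      (.inl ⟨by simp [lowPriority], rfl⟩) h1

/-- The whole execution: `N` bits are solved after `2 * N` calls that remove the high vertices. -/
theorem run_spec {N : ℕ} (hN : 0 < N) :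
    Counts N 0 (run N).events ∧ (run N).calls + 5 = 11 * 2 ^ (N - 1) + 2 * N := by
  obtain ⟨n, es, hes, -, hn, h⟩ := zielonka_sub hN N 0 (by omega) (fun _ => True) False
  have hfull : (withHigh fun _ => 0).verts N = Finset.univ := by
    ext v
    cases v <;> simp [withHigh]
  have := zielonka_withHigh N 0 (by omega) (n := n) (es := es) (by
    unfold Shape.won
    rw [withHigh_self N (fun _ => True) False, h]
    rfl)
  have hr := (congrArg (game N).zielonka hfull).symm.trans this
  rw [← run] at hr
  rw [hr]
  have := hn (N - 1) (by omega)
  exact ⟨hes, by simp only; omega⟩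

/-! ### The binary counter -/

/-- The identified distractions after the events `es`, starting with `X`. -/
def identifiedFrom {N : ℕ} (X : Finset (Vertex N)) (es : List (Event (Vertex N))) :
    Finset (Vertex N) :=
  es.foldl (fun X e => (X \ e.recomputed) ∪ e.identified) X

theorem identifiedFrom_append {N : ℕ} (X : Finset (Vertex N)) (es es' : List (Event (Vertex N))) :
    identifiedFrom X (es ++ es') = identifiedFrom (identifiedFrom X es) es' :=
  List.foldl_append

theorem Counts.length_eq {N k : ℕ} {es : List (Event (Vertex N))} (h : Counts N k es) :
    es.length = 3 * (2 ^ (N - k) - 1) := by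
  induction h with
  | nil => simp
  | step k h h' _ _ _ ih ih' =>
    have : N - k = (N - (k + 1)) + 1 := by omega
    have h2 : 0 < 2 ^ (N - (k + 1)) := by positivity
    simp only [List.length_append, List.length_cons, ih, ih']
    rw [this, pow_succ]
    omega

/-- The set `Y` of distractions differs from `X` in that the bits from `k` on show the number `i`
in both counters. -/
def Shows {N : ℕ} (k i : ℕ) (X Y : Finset (Vertex N)) : Prop :=
  ∀ (c : Player) (m : Fin N), .l c m ∈ Y ↔
    if k ≤ m.val then i.testBit (N - 1 - m) = true else .l c m ∈ X

theorem take_add_append {α : Type*} {l : List α} {n : ℕ} (h : l.length = n) (j : ℕ) (l' : List α) :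
    (l ++ l').take (n + j) = l ++ l'.take j := by
  subst h
  exact List.take_length_add_append j

theorem drop_add_append {α : Type*} {l : List α} {n : ℕ} (h : l.length = n) (j : ℕ) (l' : List α) :
    (l ++ l').drop (n + j) = l'.drop j := by
  subst h
  exact List.drop_length_add_append j

/-- The effect of a round of three events on the bits. Before it all bits below `k` are set, and
after it just bit `k` is set from `k` on, in both counters. -/
theorem setsBit_of_round {N : ℕ} (k : Fin N) {X Y R₁ R₂ R₃ : Finset (Vertex N)}
    (hX : ∀ c, ∀ m : Fin N, k ≤ m → .l c m ∉ X)
    (hY : Shows (k + 1) (2 ^ (N - (k + 1)) - 1) X Y)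
    (h1 : ∀ c m, .l c m ∉ R₁) (h2 : ∀ c m, .l c m ∈ R₂ ↔ k ≤ m ∧ ¬ (c = .odd ∧ m = k))
    (h3 : ∀ c m, .l c m ∈ R₃ ↔ k < m)
    {Y₁ Y₂ Y₃ : Finset (Vertex N)} (hY1 : Y₁ = Y \ R₁ ∪ {.l .even k})
    (hY2 : Y₂ = Y₁ \ R₂ ∪ {.l .odd k}) (hY3 : Y₃ = Y₂ \ R₃ ∪ {.l .even k}) :
    SetsBit .odd k Y₁ Y₂ ∧ SetsBit .even k Y Y₃ ∧
      ∀ c m, .l c m ∈ Y₃ ↔ m = k ∨ (m < k ∧ .l c m ∈ X) := by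
  have hY' : ∀ c m, .l c m ∈ Y ↔ k < m ∨ (m < k ∧ .l c m ∈ X) := by
    intro c m
    rw [hY c m]
    rcases lt_trichotomy k m with h | h | h
    · have : N - 1 - m.val < N - (k.val + 1) := by have := Fin.lt_def.mp h; omega
      simp [h, this]
    · subst h
      simp [hX c k le_rfl]
    · have h' : ¬ k.val + 1 ≤ m := by have := Fin.lt_def.mp h; omega
      simp [h, h', h.le]
  have h4 : ∀ c m, .l c m ∈ Y₁ ↔ (k < m ∨ (m < k ∧ .l c m ∈ X)) ∨ (c = .even ∧ m = k) := by
    intro c m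
    simp [hY1, hY', h1, or_comm]
  have h5 : ∀ c m, .l c m ∈ Y₂ ↔ (m < k ∧ .l c m ∈ X) ∨ (c = .odd ∧ m = k) := by
    intro c m
    simp only [hY2, Finset.mem_union, Finset.mem_sdiff, h4, h2, Finset.mem_singleton,
      Vertex.l.injEq]
    grind
  have h6 : ∀ c m, .l c m ∈ Y₃ ↔ m = k ∨ (m < k ∧ .l c m ∈ X) := by
    intro c m
    simp only [hY3, Finset.mem_union, Finset.mem_sdiff, h5, h3, Finset.mem_singleton,
      Vertex.l.injEq]
    cases c <;> grind
  refine ⟨⟨?_, ?_, ?_, ?_⟩, ⟨?_, ?_, ?_, ?_⟩, h6⟩ <;> simp only [hY', h4, h5, h6] <;> grind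

/-- The progression of both counters through a `Counts` list, for any start `X` in which the bits
from `k` on are unset. -/
theorem Counts.spec {N k : ℕ} {es : List (Event (Vertex N))} (h : Counts N k es)
    (X : Finset (Vertex N)) (hX : ∀ c, ∀ m : Fin N, k ≤ m → .l c m ∉ X) :
    (∀ i < 2 ^ (N - k), Shows k i X (identifiedFrom X (es.take (3 * i)))) ∧
    (∀ i < 2 ^ (N - k) - 1, ∃ b : Fin N,
      ((es.drop (3 * i)).take 3).map Event.identified = [{.l .even b}, {.l .odd b}, {.l .even b}] ∧
      SetsBit .odd b (identifiedFrom X (es.take (3 * i + 1)))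
        (identifiedFrom X (es.take (3 * i + 2))) ∧
      SetsBit .even b (identifiedFrom X (es.take (3 * i)))
        (identifiedFrom X (es.take (3 * i + 3)))) := by
  induction h generalizing X with
  | nil =>
    constructor
    · intro i hi c m
      have : ¬ N ≤ m.val := by omega
      simp [this, identifiedFrom]
    · simp
  | @step k es es' R₁ R₂ R₃ h h' h1 h2 h3 ih ih' =>
    have hlen := h.length_eq
    have hlen' := h'.length_eq
    set d := N - (k.val + 1) with hd
    have hd' : N - k.val = d + 1 := by omega
    have hpos : 0 < 2 ^ d := by positivity
    rw [hd', pow_succ]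
    obtain ⟨iha, ihb⟩ := ih X fun c m hm => hX c m (by omega)
    have hlast : Shows (k + 1) (2 ^ d - 1) X (identifiedFrom X es) := by
      have := iha (2 ^ d - 1) (by omega)
      rwa [← hlen, List.take_length] at this
    obtain ⟨hr1, hr2, hr3⟩ := setsBit_of_round k hX hlast h1 h2 h3 rfl rfl rfl
    set Y := identifiedFrom X es with hY
    set Y₁ := Y \ R₁ ∪ {.l .even k} with hY1
    set Y₂ := Y₁ \ R₂ ∪ {.l .odd k} with hY2
    set Y₃ := Y₂ \ R₃ ∪ {.l .even k} with hY3
    obtain ⟨iha', ihb'⟩ := ih' Y₃ fun c m hm => by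
      rw [hr3]
      have : ¬ (m = k) ∧ ¬ m < k := by rw [Fin.ext_iff, Fin.lt_def]; omega
      tauto
    set es₃ := (⟨{.l .even k}, R₁⟩ :: ⟨{.l .odd k}, R₂⟩ :: ⟨{.l .even k}, R₃⟩ :: es' :
      List (Event (Vertex N))) with hes3
    have htake1 : ∀ j ≤ 3 * (2 ^ d - 1), identifiedFrom X ((es ++ es₃).take j) =
        identifiedFrom X (es.take j) := fun j hj => by
      rw [List.take_append_of_le_length (by omega)]
    have htake2 : ∀ j, identifiedFrom X ((es ++ es₃).take (3 * (2 ^ d - 1) + j)) =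
        identifiedFrom Y (es₃.take j) := fun j => by
      rw [take_add_append hlen, identifiedFrom_append]
    have htake3 : ∀ i j, identifiedFrom X ((es ++ es₃).take (3 * (2 ^ d + i) + j)) =
        identifiedFrom Y₃ (es'.take (3 * i + j)) := fun i j => by
      rw [show 3 * (2 ^ d + i) + j = 3 * (2 ^ d - 1) + (3 * i + j + 3) by omega, htake2]
      rfl
    constructor
    · intro i hi
      rcases lt_or_ge i (2 ^ d) with hi' | hi'
      · rw [htake1 _ (by omega)]
        intro c m
        rw [iha i hi' c m]
        rcases lt_trichotomy k m with h | h | h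
        · have h' := Fin.lt_def.mp h
          rw [if_pos (by omega), if_pos (by omega)]
        · subst h
          have : N - 1 - k.val = d := by omega
          simp [hX c k le_rfl, this, Nat.testBit_lt_two_pow hi']
        · have h' := Fin.lt_def.mp h
          rw [if_neg (by omega), if_neg (by omega)]
      · obtain ⟨i, rfl⟩ := Nat.exists_eq_add_of_le hi'
        have := htake3 i 0
        rw [add_zero, add_zero] at this
        rw [this]
        intro c m
        rw [iha' i (by omega) c m, hr3]
        rcases lt_trichotomy k m with h | h | h
        · have h' := Fin.lt_def.mp h
          rw [if_pos (by omega), if_pos (by omega), Nat.testBit_two_pow_add_gt (by omega)]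
        · subst h
          have : N - 1 - k.val = d := by omega
          simp [this, Nat.testBit_two_pow_add_eq, Nat.testBit_lt_two_pow (show i < 2 ^ d by omega)]
        · have h' := Fin.lt_def.mp h
          rw [if_neg (by omega), if_neg (by omega)]
          simp [h, h.ne]
    · intro i hi
      rcases lt_trichotomy i (2 ^ d - 1) with hi' | rfl | hi'
      · obtain ⟨b, hb1, hb2, hb3⟩ := ihb i hi'
        refine ⟨b, ?_, ?_, ?_⟩
        · rw [List.drop_append_of_le_length (by omega), List.take_append_of_le_length
            (by rw [List.length_drop]; omega), hb1]
        · rwa [htake1 _ (by omega), htake1 _ (by omega)]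
        · rwa [htake1 _ (by omega), htake1 _ (by omega)]
      · refine ⟨k, ?_, ?_, ?_⟩
        · have := drop_add_append hlen 0 es₃
          rw [add_zero] at this
          rw [this]
          rfl
        · rw [htake2, htake2]
          exact hr1
        · have := htake2 0
          rw [add_zero] at this
          rw [this, htake2]
          exact hr2
      · obtain ⟨i, rfl⟩ := Nat.exists_eq_add_of_le (show 2 ^ d ≤ i by omega)
        obtain ⟨b, hb1, hb2, hb3⟩ := ihb' i (by omega)
        refine ⟨b, ?_, ?_, ?_⟩
        · rw [show 3 * (2 ^ d + i) = 3 * (2 ^ d - 1) + (3 * i + 3) by omega, drop_add_append hlen,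
            ← hb1]
          rfl
        · rwa [htake3, htake3]
        · have := htake3 i 0
          rw [add_zero, add_zero] at this
          rwa [this, htake3]

/-- The binary expansion of `i`, with the most significant bit first. -/
theorem sum_testBit (n i : ℕ) (hi : i < 2 ^ n) :
    ∑ k : Fin n, (if i.testBit (n - 1 - k) then 2 ^ (n - 1 - k.val) else 0) = i := by
  -- Reversed, the sum runs from the least significant bit on.
  rw [← Equiv.sum_comp Fin.revPerm]
  have : ∀ k : Fin n, n - 1 - (Fin.revPerm k).val = k := fun k => by
    simp only [Fin.revPerm_apply, Fin.val_rev]; omega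
  simp only [this]
  rw [Fin.sum_univ_eq_sum_range (fun j => if i.testBit j then 2 ^ j else 0)]
  induction n generalizing i with
  | zero => simp at hi; simp [hi]
  | succ n ih =>
    rw [Finset.sum_range_succ]
    rcases lt_or_ge i (2 ^ n) with h | h
    · rw [ih i h fun k => by simp only [Fin.revPerm_apply, Fin.val_rev]; omega,
        Nat.testBit_lt_two_pow h]
      simp
    · obtain ⟨i, rfl⟩ := Nat.exists_eq_add_of_le h
      have h' : i < 2 ^ n := by rw [pow_succ] at hi; omega
      rw [Nat.testBit_two_pow_add_eq, Nat.testBit_lt_two_pow h', Finset.sum_congr rfl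
        (g := fun j => if i.testBit j then 2 ^ j else 0) fun j hj => by
          rw [Nat.testBit_two_pow_add_gt (Finset.mem_range.mp hj)],
        ih i h' fun k => by simp only [Fin.revPerm_apply, Fin.val_rev]; omega]
      simp [add_comm]

/-! ### The number of vertices -/

/-- A vertex is given by its player, its bit and its place in the bit. -/
def vertexEquiv (N : ℕ) :
    Vertex N ≃ Player × (Σ k : Fin N, Fin 3 ⊕ Fin (k.val + 1) ⊕ Fin k.val ⊕ Fin k.val) where
  toFun
    | .l c k => (c, ⟨k, .inl 0⟩)
    | .t c k => (c, ⟨k, .inl 1⟩)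
    | .h c k => (c, ⟨k, .inl 2⟩)
    | .s c k j => (c, ⟨k, .inr (.inl j)⟩)
    | .a c k j => (c, ⟨k, .inr (.inr (.inl j))⟩)
    | .b c k j => (c, ⟨k, .inr (.inr (.inr j))⟩)
  invFun
    | (c, ⟨k, .inl 0⟩) => .l c k
    | (c, ⟨k, .inl 1⟩) => .t c k
    | (c, ⟨k, .inl 2⟩) => .h c k
    | (c, ⟨k, .inr (.inl j)⟩) => .s c k j
    | (c, ⟨k, .inr (.inr (.inl j))⟩) => .a c k j
    | (c, ⟨k, .inr (.inr (.inr j))⟩) => .b c k j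
  left_inv v := by cases v <;> rfl
  right_inv := by
    rintro ⟨c, k, i | j | j | j⟩
    · fin_cases i <;> rfl
    all_goals rfl

theorem card_vertex (N : ℕ) : Fintype.card (Vertex N) = 3 * N ^ 2 + 5 * N := by
  rw [Fintype.card_congr (vertexEquiv N), Fintype.card_prod, show Fintype.card Player = 2 from rfl]
  simp only [Fintype.card_sigma, Fintype.card_sum, Fintype.card_fin]
  rw [Fin.sum_univ_eq_sum_range (fun k => 3 + (k + 1 + (k + k)))]
  induction N with
  | zero => rfl
  | succ n ih =>
    rw [Finset.sum_range_succ, mul_add, ih]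
    ring

end TwoCounters

theorem lemma1 :
    (∀ N : ℕ, 1 ≤ N →
      -- the size of the game
      Fintype.card (TwoCounters.Vertex N) = 3 * N ^ 2 + 5 * N ∧
      -- each increment of the counters consists of three identifications of distractions
      (TwoCounters.run N).events.length = 3 * (2 ^ N - 1) ∧
      -- after `i` increments both counters show `i`
      (∀ i ≤ 2 ^ N - 1, ∀ c : Player,
        TwoCounters.counterValue c (TwoCounters.state N (3 * i)) = i) ∧
      -- the increment from `i` to `i + 1` sets some bit `k`, first for Even and then for Odd
      (∀ i < 2 ^ N - 1, ∃ k : Fin N,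
        (((TwoCounters.run N).events.drop (3 * i)).take 3).map ParityGame.Event.identified =
          [{TwoCounters.Vertex.l Player.even k}, {TwoCounters.Vertex.l Player.odd k},
            {TwoCounters.Vertex.l Player.even k}] ∧
        TwoCounters.SetsBit Player.odd k
          (TwoCounters.state N (3 * i + 1)) (TwoCounters.state N (3 * i + 2)) ∧
        TwoCounters.SetsBit Player.even k
          (TwoCounters.state N (3 * i)) (TwoCounters.state N (3 * i + 3))) ∧
      -- the number of recursive calls
      2 * (2 ^ N - 1) ≤ (TwoCounters.run N).calls ∧
      (TwoCounters.run N).calls ≤ 6 * 2 ^ N) ∧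
    -- the lower bound in terms of the number of vertices
    (fun N : ℕ => (2 : ℝ) ^ Real.sqrt ((Fintype.card (TwoCounters.Vertex N) : ℝ) / 3))
      =O[Filter.atTop] (fun N : ℕ => ((TwoCounters.run N).calls : ℝ)) := by
  have hlow : ∀ N : ℕ, 1 ≤ N → 2 ^ N ≤ (TwoCounters.run N).calls := fun N hN => by
    have h := (TwoCounters.run_spec hN).2
    obtain ⟨n, rfl⟩ := Nat.exists_eq_add_of_le' hN
    rw [Nat.add_sub_cancel] at h
    have : 0 < 2 ^ n := by positivity
    rw [pow_succ]
    omega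
  constructor
  · intro N hN
    obtain ⟨hc, hcalls⟩ := TwoCounters.run_spec hN
    obtain ⟨h1, h2⟩ := hc.spec ∅ (by simp)
    have hpos : 0 < 2 ^ N := by positivity
    -- The exact number of calls is `11 * 2 ^ (N - 1) - 5 + 2 * N`.
    have hNle : 2 * N ≤ 2 ^ (N - 1) + 5 := by
      have : N - 1 < 2 ^ (N - 1) := Nat.lt_two_pow_self
      rcases le_or_gt N 4 with h | h
      · interval_cases N <;> simp
      · obtain ⟨n, rfl⟩ := Nat.exists_eq_add_of_le' h
        have h' : n < 2 ^ n := Nat.lt_two_pow_self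
        rw [show n + 4 + 1 - 1 = n + 4 by omega, pow_add]
        omega
    have htwo : 2 ^ N = 2 * 2 ^ (N - 1) := by
      rw [← pow_succ', Nat.sub_add_cancel hN]
    refine ⟨TwoCounters.card_vertex N, hc.length_eq, fun i hi c => ?_, h2, by omega, by omega⟩
    have hs := h1 i (by rw [Nat.sub_zero]; omega)
    rw [TwoCounters.counterValue]
    refine (Finset.sum_congr rfl fun k _ => ?_).trans (TwoCounters.sum_testBit N i (by omega))
    have := hs c k
    rw [if_pos (Nat.zero_le _)] at this
    exact if_congr this rfl rfl
  · refine Asymptotics.IsBigO.of_bound 2 ?_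
    filter_upwards [Filter.eventually_ge_atTop 1] with N hN
    -- `N ^ 2 + 5 * N / 3 ≤ (N + 1) ^ 2`
    have h1 : Real.sqrt ((Fintype.card (TwoCounters.Vertex N) : ℝ) / 3) ≤ N + 1 := by
      rw [TwoCounters.card_vertex]
      refine Real.sqrt_le_iff.mpr ⟨by positivity, ?_⟩
      push_cast
      have : (0 : ℝ) ≤ N := by positivity
      nlinarith
    have h2 : (2 : ℝ) ^ N ≤ (TwoCounters.run N).calls := by exact_mod_cast hlow N hN
    rw [Real.norm_of_nonneg (by positivity), Real.norm_of_nonneg (by positivity)]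
    calc (2 : ℝ) ^ Real.sqrt ((Fintype.card (TwoCounters.Vertex N) : ℝ) / 3)
        ≤ 2 ^ ((N : ℝ) + 1) := Real.rpow_le_rpow_of_exponent_le one_le_two h1
      _ = 2 * 2 ^ N := by
        rw [Real.rpow_add two_pos, Real.rpow_one, Real.rpow_natCast, mul_comm]
      _ ≤ 2 * (TwoCounters.run N).calls := by gcongr
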